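/- Let $\mathfrak a\in\mathbb R\setminus\{0\}$, $\gamma>0$, $b>0$, $\lambda>0$, and let $\theta$ be a real measurable function with compact support such that $1-\frac sb\le\theta(s)\le1+\frac sb$ for all $s\ge0$. Put $\beta(\mathbf y)=-\frac1{\mathfrak a}+\gamma\,\frac{\theta(|\mathbf y|)-1}{|\mathbf y|}$ for $\mathbf y\in\mathbb R^3\setminus\{0\}$. Write $\hat\varphi(\mathbf p)=(2\pi)^{-3/2}\int_{\mathbb R^3}e^{-i\mathbf p\cdot\mathbf x}\varphi(\mathbf x)\,d\mathbf x$ for the unitary Fourier transform on $L^2(\mathbb R^3)$ and, for $\varphi\in H^{1/2}(\mathbb R^3)$ (complex-valued), set $$\Phi^\lambda_{\mathrm{diag}}[\varphi]=12\pi\int_{\mathbb R^3}\sqrt{\tfrac34|\mathbf p|^2+\lambda}\;|\hat\varphi(\mathbf p)|^2\,d\mathbf p,\qquad \Phi^\lambda_{\mathrm{off}}[\varphi]=-\frac{12}{\pi}\int_{\mathbb R^6}\frac{\overline{\hat\varphi(\mathbf p)}\,\hat\varphi(\mathbf q)}{|\mathbf p|^2+|\mathbf q|^2+\mathbf p\cdot\mathbf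 q+\lambda}\,d\mathbf p\,d\mathbf q,$$ $$\Phi_{\mathrm{reg}}[\varphi]=\frac{6\gamma}{\pi}\int_{\mathbb R^6}\frac{\overline{\hat\varphi(\mathbf p)}\,\hat\varphi(\mathbf q)}{|\mathbf p-\mathbf q|^2}\,d\mathbf p\,d\mathbf q,\qquad \Phi_0[\varphi]=12\pi\int_{\mathbb R^3}\beta(\mathbf y)\,|\varphi(\mathbf y)|^2\,d\mathbf y,$$ $$\Phi^\lambda=\Phi^\lambda_{\mathrm{diag}}+\Phi^\lambda_{\mathrm{off}}+\Phi_{\mathrm{reg}}+\Phi_0,\qquad [\varphi]^2_{1/2}=\int_{\mathbb R^6}\frac{|\varphi(\mathbf x)-\varphi(\mathbf y)|^2}{|\mathbf x-\mathbf y|^4}\,d\mathbf x\,d\mathbf y .$$ Then, for every $\varphi\in H^{1/2}(\mathbb R^3)$, all these integrals converge absolutely, and $$\Phi^\lambda[\varphi]\ \ge\ \Phi^\lambda_{\mathrm{diag}}[\varphi]+\Phi_0[\varphi]+3\min\{0,\gamma-2\}\,[\varphi]^2_{1/2},$$ $$\Phi^\lambda[\varphi]\ \le\ \Phi^\lambda_{\mathrm{diag}}[\varphi]+\Phi_0[\varphi]+\Big(3\gamma+\frac{96\sqrt3}{\pi}\Big)[\varphi]^2_{1/2}.$$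 -/

import Mathlib

open MeasureTheory

noncomputable section

namespace ThreeBosons

open scoped FourierTransform SchwartzMap ComplexConjugate

/-- Three-dimensional Euclidean space. -/
abbrev E3 : Type := EuclideanSpace ℝ (Fin 3)

/-- The complex Hilbert space `L²(ℝ³)`. -/
abbrev L2 : Type := Lp ℂ 2 (volume : Measure E3)

/-- The Sobolev space `H^{1/2}(ℝ³)`, as a predicate on `L²(ℝ³)`. -/
def MemHHalf (ξ : L2) : Prop :=
  TemperedDistribution.MemSobolev (1 / 2) 2 (ξ : 𝓢'(E3, ℂ))

/-- The unitary Fourier transform in the normalization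
`(2π)^{-3/2} ∫ exp (-i p·x) ξ(x) dx`, obtained by rescaling Mathlib's `L²` Fourier transform, whose
kernel is `exp (-2πi p·x)`. -/
def hat (ξ : L2) (p : E3) : ℂ :=
  (((2 * Real.pi) ^ (-(3 / 2) : ℝ) : ℝ) : ℂ) * (𝓕 ξ : L2) ((2 * Real.pi)⁻¹ • p)

/-- Integrand of the diagonal form. -/
def diagIntegrand (lam : ℝ) (ξ : L2) (p : E3) : ℝ :=
  √(3 / 4 * ‖p‖ ^ 2 + lam) * ‖hat ξ p‖ ^ 2

/-- `Φ^λ_diag`. -/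
def phiDiag (lam : ℝ) (ξ : L2) : ℝ :=
  12 * Real.pi * ∫ p : E3, diagIntegrand lam ξ p

/-- Integrand of the off-diagonal form, on `ℝ³ × ℝ³`. -/
def offIntegrand (lam : ℝ) (ξ : L2) (z : E3 × E3) : ℂ :=
  conj (hat ξ z.1) * hat ξ z.2 /
    ((‖z.1‖ ^ 2 + ‖z.2‖ ^ 2 + inner ℝ z.1 z.2 + lam : ℝ) : ℂ)

/-- `Φ^λ_off`; the integral is a real number, see `ofReal_phiOff`. -/
def phiOff (lam : ℝ) (ξ : L2) : ℝ :=
  -(12 / Real.pi) * (∫ z : E3 × E3, offIntegrand lam ξ z).re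

/-- Integrand of the regularizing form, on `ℝ³ × ℝ³`. -/
def regIntegrand (ξ : L2) (z : E3 × E3) : ℂ :=
  conj (hat ξ z.1) * hat ξ z.2 / ((‖z.1 - z.2‖ ^ 2 : ℝ) : ℂ)

/-- `Φ_reg`; the integral is a real number, see `ofReal_phiReg`. -/
def phiReg (γ : ℝ) (ξ : L2) : ℝ :=
  6 * γ / Real.pi * (∫ z : E3 × E3, regIntegrand ξ z).re

/-- The function `β(y) = -1/a + γ (θ(|y|) - 1)/|y|`. -/
def beta (a γ : ℝ) (θ : ℝ → ℝ) (y : E3) : ℝ :=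
  -(1 / a) + γ * ((θ ‖y‖ - 1) / ‖y‖)

/-- Integrand of `Φ_0`. -/
def zeroIntegrand (a γ : ℝ) (θ : ℝ → ℝ) (ξ : L2) (y : E3) : ℝ :=
  beta a γ θ y * ‖ξ y‖ ^ 2

/-- `Φ_0`. -/
def phiZero (a γ : ℝ) (θ : ℝ → ℝ) (ξ : L2) : ℝ :=
  12 * Real.pi * ∫ y : E3, zeroIntegrand a γ θ ξ y

/-- The form `Φ^λ = Φ^λ_diag + Φ^λ_off + Φ_reg + Φ_0`. -/
def phi (a γ : ℝ) (θ : ℝ → ℝ) (lam : ℝ) (ξ : L2) : ℝ :=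
  phiDiag lam ξ + phiOff lam ξ + phiReg γ ξ + phiZero a γ θ ξ

/-- Integrand of the squared Gagliardo seminorm, on `ℝ³ × ℝ³`. -/
def gagliardoIntegrand (u : L2) (z : E3 × E3) : ℝ :=
  ‖u z.1 - u z.2‖ ^ 2 / ‖z.1 - z.2‖ ^ 4

/-- The squared Gagliardo seminorm `[u]²_{1/2}`. -/
def gagliardoSq (u : L2) : ℝ :=
  ∫ z : E3 × E3, gagliardoIntegrand u z

/-- The integral of a kernel with `F (q, p) = conj (F (p, q))` is real. -/
theorem integral_im_eq_zero_of_hermitian (F : E3 × E3 → ℂ)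
    (hF : ∀ z, F z.swap = conj (F z)) : (∫ z, F z).im = 0 := by
  have h : ∫ z, F z = conj (∫ z, F z) := by
    rw [← integral_conj]
    simp_rw [← hF]
    exact (integral_prod_swap (μ := (volume : Measure E3)) (ν := (volume : Measure E3)) F).symm
  exact Complex.conj_eq_iff_im.1 h.symm

/-- The off-diagonal form is the full complex integral. -/
theorem ofReal_phiOff (lam : ℝ) (ξ : L2) :
    (phiOff lam ξ : ℂ) = -(12 / Real.pi) * ∫ z : E3 × E3, offIntegrand lam ξ z := by
  have h := integral_im_eq_zero_of_hermitian (offIntegrand lam ξ) (fun z => by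
    simp only [offIntegrand, Prod.fst_swap, Prod.snd_swap, map_div₀, map_mul, Complex.conj_conj,
      Complex.conj_ofReal, real_inner_comm z.1 z.2, add_comm (‖z.2‖ ^ 2)]
    rw [mul_comm])
  apply Complex.ext <;> simp [phiOff, h]

/-- The regularizing form is the full complex integral. -/
theorem ofReal_phiReg (γ : ℝ) (ξ : L2) :
    (phiReg γ ξ : ℂ) = 6 * γ / Real.pi * ∫ z : E3 × E3, regIntegrand ξ z := by
  have h := integral_im_eq_zero_of_hermitian (regIntegrand ξ) (fun z => by
    simp only [regIntegrand, Prod.fst_swap, Prod.snd_swap, map_div₀, map_mul, Complex.conj_conj,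
      Complex.conj_ofReal, norm_sub_rev z.2 z.1]
    rw [mul_comm])
  have e : (6 * γ / Real.pi : ℂ) = ((6 * γ / Real.pi : ℝ) : ℂ) := by push_cast; rfl
  rw [e]
  apply Complex.ext
  · simp only [phiReg, Complex.ofReal_re, Complex.re_ofReal_mul]
  · simp only [Complex.ofReal_im, Complex.im_ofReal_mul, h, mul_zero]

end ThreeBosons

end

/-! Write r and o for the double integrals of conj(f(p)) f(q), f = φ̂, against 1/|p-q|² and
1/(|p|²+|q|²+p·q+λ), and Q for the squared Gagliardo seminorm. The diagonal and local terms cancel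
on both sides, so only (12/π)(-o) + (6γ/π) r has to be estimated. Three facts suffice: 0 ≤ r ≤ (π/2)
Q, o ≤ r, and |o| ≤ 2π Q.

Positivity (`integral_kernel_diff_re_nonneg`). By 1/A = ∫₀^∞ exp(-tA) dt, the kernel of r - εo is a
superposition of differences of Gaussians. Once exp(-t|p|²) exp(-t|q|²) is absorbed into f, what
remains is exp(2t p·q) - δ exp(-t p·q) with δ = ε exp(-tλ) in [0,1]. Its power series in p·q has
coefficients tⁿ(2ⁿ - δ(-1)ⁿ)/n! ≥ 0, and each power (p·q)ⁿ is a sum of rank-one positive kernels.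
Taking ε = 0 gives r ≥ 0, and ε = 1 gives o ≤ r.

Size (`lintegral_mul_div_norm_sub_sq_le`, `lintegral_gagliardoIntegrand_eq_hat`). A Schur test with
weight |p|² bounds the absolute version of r by π³ ∫ |p||f|², while Plancherel applied to
differences u - u(· - a) gives Q = 2π² ∫ |p||f|²; the quotient is π/2. Since 4(|p|²+|q|²+p·q) -
|p-q|² = 3|p+q|², the kernel of o is at most four times that of r.

The lower bound comes from (12/π)(r - o) + (6/π)(γ-2) r. The upper bound comes from estimating the
two terms separately, which gives 3γ + 24, and 24 ≤ 96√3/π. -/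

namespace ThreeBosons

open scoped FourierTransform SchwartzMap ComplexConjugate ENNReal Topology
open Set Filter

/-! ### Fundamental theorem of calculus for nonnegative Lebesgue integrals -/

/-- The fundamental theorem of calculus on a half-line, as a Lebesgue integral. -/
theorem lintegral_Ioi_deriv_of_nonneg {g g' : ℝ → ℝ} {a l : ℝ}
    (hcont : ContinuousWithinAt g (Ici a) a) (hderiv : ∀ x ∈ Ioi a, HasDerivAt g (g' x) x)
    (hpos : ∀ x ∈ Ioi a, 0 ≤ g' x) (hg : Tendsto g atTop (𝓝 l)) :
    ∫⁻ x in Ioi a, ENNReal.ofReal (g' x) = ENNReal.ofReal (l - g a) := by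
  rw [← integral_Ioi_of_hasDerivAt_of_nonneg hcont hderiv hpos hg,
    ofReal_integral_eq_lintegral_ofReal (integrableOn_Ioi_deriv_of_nonneg hcont hderiv hpos hg)]
  filter_upwards [ae_restrict_mem measurableSet_Ioi] with x hx using hpos x hx

/-- The fundamental theorem of calculus on a bounded interval, as a Lebesgue integral. -/
theorem lintegral_Ioo_deriv_of_nonneg {g g' : ℝ → ℝ} {a b : ℝ} (hab : a ≤ b)
    (hcont : ContinuousOn g (Icc a b)) (hderiv : ∀ x ∈ Ioo a b, HasDerivAt g (g' x) x)
    (hpos : ∀ x ∈ Ioo a b, 0 ≤ g' x) :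
    ∫⁻ x in Ioo a b, ENNReal.ofReal (g' x) = ENNReal.ofReal (g b - g a) := by
  have hi : IntervalIntegrable g' volume a b := by
    rw [intervalIntegrable_iff_integrableOn_Ioc_of_le hab]
    exact intervalIntegral.integrableOn_deriv_of_nonneg hcont hderiv hpos
  rw [← intervalIntegral.integral_eq_sub_of_hasDerivAt_of_le hab hcont hderiv hi,
    intervalIntegral.integral_of_le hab, integral_Ioc_eq_integral_Ioo,
    ofReal_integral_eq_lintegral_ofReal]
  · exact (intervalIntegrable_iff_integrableOn_Ioo_of_le hab).1 hi
  · filter_upwards [ae_restrict_mem measurableSet_Ioo] with x hx using hpos x hx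

/-! ### The Kato–Herbst inequality in momentum space -/

theorem lintegral_Ioo_inv_sqrt_mul_one_sub :
    ∫⁻ v in Ioo (0 : ℝ) 1, ENNReal.ofReal (1 / √(v * (1 - v))) = ENNReal.ofReal Real.pi := by
  have h := lintegral_Ioo_deriv_of_nonneg (g := fun v => Real.arcsin (2 * v - 1))
    (g' := fun v => 1 / √(v * (1 - v))) (zero_le_one' ℝ) (by fun_prop) (fun v hv => by
      have h1 : HasDerivAt (fun v : ℝ => 2 * v - 1) 2 v := by
        simpa using ((hasDerivAt_id v).const_mul 2).sub_const 1
      have h2 := (Real.hasDerivAt_arcsin (x := 2 * v - 1) (by linarith [hv.1])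
        (by linarith [hv.2])).comp v h1
      refine h2.congr_deriv ?_
      rw [show 1 - (2 * v - 1) ^ 2 = 2 ^ 2 * (v * (1 - v)) by ring,
        Real.sqrt_mul (by norm_num), Real.sqrt_sq (by norm_num)]
      ring) (fun v hv => by positivity)
  rw [h]
  norm_num

/-- Feynman's parameter trick: two quadratic singularities merge into the square of one quadratic
polynomial, whose integral over momentum space becomes radial after a shift. -/
theorem lintegral_Ioo_feynman {A B : ℝ} (hA : 0 < A) (hB : 0 < B) :
    ∫⁻ v in Ioo (0 : ℝ) 1, ENNReal.ofReal (1 / (v * A + (1 - v) * B) ^ 2) =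
      ENNReal.ofReal (1 / (A * B)) := by
  have hp : ∀ v ∈ Icc (0 : ℝ) 1, 0 < v * A + (1 - v) * B := fun v hv => by
    rcases eq_or_lt_of_le hv.1 with h | h
    · subst h; simpa
    · nlinarith [mul_pos h hA, mul_nonneg (sub_nonneg.2 hv.2) hB.le]
  rw [lintegral_Ioo_deriv_of_nonneg (g := fun v => v / (B * (v * A + (1 - v) * B)))
    (zero_le_one' ℝ)]
  · congr 1
    simp
    ring
  · refine ContinuousOn.div (by fun_prop) (by fun_prop) fun v hv => ?_
    exact (mul_pos hB (hp v hv)).ne'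
  · intro v hv
    have hv' := (hp v (Ioo_subset_Icc_self hv)).ne'
    have h1 : HasDerivAt (fun v : ℝ => B * (v * A + (1 - v) * B)) (B * (A - B)) v := by
      have := ((hasDerivAt_id v).mul_const A).add
        (((hasDerivAt_id v).const_sub 1).mul_const B)
      refine (this.const_mul B).congr_deriv ?_
      ring
    refine ((hasDerivAt_id v).div h1 (mul_ne_zero hB.ne' hv')).congr_deriv ?_
    simp only [id]
    field_simp
    ring
  · intro v _
    positivity

theorem lintegral_inv_norm_sq_add_sq {m : ℝ} (hm : 0 < m) :
    ∫⁻ q : E3, ENNReal.ofReal (1 / (‖q‖ ^ 2 + m ^ 2) ^ 2) = ENNReal.ofReal (Real.pi ^ 2 / m) := by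
  -- Antiderivative of the radial integrand r²/(r²+m²)². Its limit π/(4m), times the sphere area 4π,
  -- gives π²/m.
  set g : ℝ → ℝ := fun r => (Real.arctan (r / m) / m - r / (r ^ 2 + m ^ 2)) / 2
  have hd : ∀ r : ℝ, HasDerivAt g (r ^ 2 * (1 / (r ^ 2 + m ^ 2) ^ 2)) r := by
    intro r
    have h0 : r ^ 2 + m ^ 2 ≠ 0 := by positivity
    have h1 := (((hasDerivAt_id r).div_const m).arctan).div_const m
    have h2 := (hasDerivAt_id r).div (((hasDerivAt_id r).pow 2).add_const (m ^ 2)) h0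
    refine ((h1.sub h2).div_const 2).congr_deriv ?_
    simp only [id, Pi.pow_apply]
    field_simp
    push_cast
    ring
  have ht : Tendsto g atTop (𝓝 (Real.pi / (4 * m))) := by
    have h1 : Tendsto (fun r : ℝ => Real.arctan (r / m)) atTop (𝓝 (Real.pi / 2)) :=
      (tendsto_nhds_of_tendsto_nhdsWithin Real.tendsto_arctan_atTop).comp
        (tendsto_id.atTop_div_const hm)
    have h2 : Tendsto (fun r : ℝ => r / (r ^ 2 + m ^ 2)) atTop (𝓝 0) := by
      refine squeeze_zero' (g := fun r => r⁻¹) ?_ ?_ tendsto_inv_atTop_zero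
      · filter_upwards [eventually_ge_atTop 0] with r hr using by positivity
      · filter_upwards [eventually_gt_atTop 0] with r hr
        rw [div_le_iff₀ (by positivity)]
        field_simp
        nlinarith
    have := ((h1.div_const m).sub h2).div_const 2
    convert this using 2
    field_simp
    ring
  have hpos : ∀ r ∈ Ioi (0 : ℝ), 0 ≤ r ^ 2 * (1 / (r ^ 2 + m ^ 2) ^ 2) := fun r _ => by positivity
  have hint := integrableOn_Ioi_deriv_of_nonneg (hd 0).continuousAt.continuousWithinAt
    (fun r _ => hd r) hpos ht
  have hval := integral_Ioi_of_hasDerivAt_of_nonneg (hd 0).continuousAt.continuousWithinAt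
    (fun r _ => hd r) hpos ht
  have hI : Integrable (fun q : E3 => 1 / (‖q‖ ^ 2 + m ^ 2) ^ 2) := by
    rw [integrable_fun_norm_addHaar volume (f := fun r => 1 / (r ^ 2 + m ^ 2) ^ 2)]
    simpa using hint
  rw [← ofReal_integral_eq_lintegral_ofReal hI (ae_of_all _ fun q => by positivity),
    integral_fun_norm_addHaar volume (fun r => 1 / (r ^ 2 + m ^ 2) ^ 2)]
  congr 1
  have hb : (volume : Measure E3).real (Metric.ball 0 1) = 4 / 3 * Real.pi := by
    rw [Measure.real, EuclideanSpace.volume_ball_fin_three]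
    rw [ENNReal.toReal_mul, ENNReal.toReal_pow, ENNReal.toReal_ofReal (by norm_num),
      ENNReal.toReal_ofReal (by positivity)]
    ring
  simp only [finrank_euclideanSpace, Fintype.card_fin, smul_eq_mul, nsmul_eq_mul] at hval ⊢
  simp only [Nat.add_one_sub_one, hb] at hval ⊢
  norm_num at hval ⊢
  rw [hval]
  simp [g]
  field_simp

theorem convex_norm_sq_sub (p q : E3) (v : ℝ) :
    v * ‖q‖ ^ 2 + (1 - v) * ‖p - q‖ ^ 2 = ‖q - (1 - v) • p‖ ^ 2 + v * (1 - v) * ‖p‖ ^ 2 := by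
  rw [norm_sub_sq_real, norm_sub_sq_real, inner_smul_right, norm_smul, mul_pow, real_inner_comm,
    Real.norm_eq_abs, sq_abs]
  ring

/-- After the Feynman trick and completing the square, the momentum integral is centred with m =
√(v(1-v)) |p|. It equals π²/m, and the remaining v-integral supplies the third factor π. -/
theorem lintegral_inv_norm_sq_mul_inv_norm_sub_sq {p : E3} (hp : p ≠ 0) :
    ∫⁻ q : E3, ENNReal.ofReal (1 / (‖q‖ ^ 2 * ‖p - q‖ ^ 2)) =
      ENNReal.ofReal (Real.pi ^ 3 / ‖p‖) := by
  have hp' : 0 < ‖p‖ := norm_pos_iff.2 hp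
  calc ∫⁻ q : E3, ENNReal.ofReal (1 / (‖q‖ ^ 2 * ‖p - q‖ ^ 2))
      = ∫⁻ q : E3, ∫⁻ v in Ioo (0 : ℝ) 1,
          ENNReal.ofReal (1 / (v * ‖q‖ ^ 2 + (1 - v) * ‖p - q‖ ^ 2) ^ 2) := by
        refine lintegral_congr_ae ?_
        filter_upwards [Measure.ae_ne volume (0 : E3), Measure.ae_ne volume p] with q h0 hq
        have h1 : 0 < ‖q‖ := norm_pos_iff.2 h0
        have h2 : 0 < ‖p - q‖ := norm_pos_iff.2 (sub_ne_zero.2 hq.symm)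
        rw [lintegral_Ioo_feynman (by positivity) (by positivity)]
    _ = ∫⁻ v in Ioo (0 : ℝ) 1, ∫⁻ q : E3,
          ENNReal.ofReal (1 / (v * ‖q‖ ^ 2 + (1 - v) * ‖p - q‖ ^ 2) ^ 2) := by
        rw [lintegral_lintegral_swap]
        apply Measurable.aemeasurable
        unfold Function.uncurry
        fun_prop
    _ = ∫⁻ v in Ioo (0 : ℝ) 1, ENNReal.ofReal (Real.pi ^ 2 / ‖p‖) *
          ENNReal.ofReal (1 / √(v * (1 - v))) := by
        refine setLIntegral_congr_fun measurableSet_Ioo fun v hv => ?_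
        have hv' : 0 < v * (1 - v) := mul_pos hv.1 (sub_pos.2 hv.2)
        have hm : 0 < √(v * (1 - v)) * ‖p‖ := by positivity
        simp only [convex_norm_sq_sub]
        rw [lintegral_sub_right_eq_self (fun q : E3 =>
          ENNReal.ofReal (1 / (‖q‖ ^ 2 + v * (1 - v) * ‖p‖ ^ 2) ^ 2)) ((1 - v) • p)]
        have h := lintegral_inv_norm_sq_add_sq hm
        rw [mul_pow, Real.sq_sqrt hv'.le] at h
        rw [h, ← ENNReal.ofReal_mul (by positivity)]
        congr 1
        field_simp
    _ = ENNReal.ofReal (Real.pi ^ 3 / ‖p‖) := by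
        rw [lintegral_const_mul' _ _ ENNReal.ofReal_ne_top, lintegral_Ioo_inv_sqrt_mul_one_sub,
          ← ENNReal.ofReal_mul (by positivity)]
        congr 1
        ring

/-- The sharp Kato–Herbst inequality in momentum space. -/
theorem lintegral_mul_div_norm_sub_sq_le {g : E3 → ℂ} (hg : Measurable g) :
    ∫⁻ z : E3 × E3, ENNReal.ofReal (‖g z.1‖ * ‖g z.2‖ / ‖z.1 - z.2‖ ^ 2) ≤
      ENNReal.ofReal (Real.pi ^ 3) * ∫⁻ p : E3, ENNReal.ofReal (‖p‖ * ‖g p‖ ^ 2) := by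
  -- One half of the Schur-test majorant. The weight |p|²/|q|² makes the inner q-integral exactly
  -- π³/|p|, so one power of |p| survives.
  set G : E3 × E3 → ℝ≥0∞ := fun z =>
    ENNReal.ofReal (‖g z.1‖ ^ 2 * ‖z.1‖ ^ 2 / 2 * (1 / (‖z.2‖ ^ 2 * ‖z.1 - z.2‖ ^ 2)))
  have hG : Measurable G := by fun_prop
  have hGI : ∫⁻ z, G z = ENNReal.ofReal (Real.pi ^ 3 / 2) *
      ∫⁻ p : E3, ENNReal.ofReal (‖p‖ * ‖g p‖ ^ 2) := by
    rw [Measure.volume_eq_prod, lintegral_prod _ hG.aemeasurable,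
      ← lintegral_const_mul' _ _ ENNReal.ofReal_ne_top]
    refine lintegral_congr_ae ?_
    filter_upwards [Measure.ae_ne volume (0 : E3)] with p hp
    have hp' : 0 < ‖p‖ := norm_pos_iff.2 hp
    simp only [G]
    simp_rw [ENNReal.ofReal_mul (show 0 ≤ ‖g p‖ ^ 2 * ‖p‖ ^ 2 / 2 by positivity)]
    rw [lintegral_const_mul' _ _ ENNReal.ofReal_ne_top,
      lintegral_inv_norm_sq_mul_inv_norm_sub_sq hp, ← ENNReal.ofReal_mul (by positivity),
      ← ENNReal.ofReal_mul (by positivity)]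
    congr 1
    field_simp
  have hne1 : ∀ᵐ z : E3 × E3, z.1 ≠ 0 :=
    Measure.quasiMeasurePreserving_fst.ae (Measure.ae_ne volume (0 : E3))
  have hne2 : ∀ᵐ z : E3 × E3, z.2 ≠ 0 :=
    Measure.quasiMeasurePreserving_snd.ae (Measure.ae_ne volume (0 : E3))
  calc ∫⁻ z : E3 × E3, ENNReal.ofReal (‖g z.1‖ * ‖g z.2‖ / ‖z.1 - z.2‖ ^ 2)
      ≤ ∫⁻ z : E3 × E3, (G z + G z.swap) := by
        refine lintegral_mono_ae ?_
        filter_upwards [hne1, hne2] with z h1 h2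
        have h1' : 0 < ‖z.1‖ := norm_pos_iff.2 h1
        have h2' : 0 < ‖z.2‖ := norm_pos_iff.2 h2
        simp only [G, Prod.fst_swap, Prod.snd_swap]
        rw [← ENNReal.ofReal_add (by positivity) (by positivity), norm_sub_rev z.2 z.1]
        refine ENNReal.ofReal_le_ofReal ?_
        have key : ‖g z.1‖ * ‖g z.2‖ ≤ ‖g z.1‖ ^ 2 * ‖z.1‖ ^ 2 / 2 / ‖z.2‖ ^ 2 +
            ‖g z.2‖ ^ 2 * ‖z.2‖ ^ 2 / 2 / ‖z.1‖ ^ 2 := by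
          -- AM-GM with weights |p|/|q| and |q|/|p|, whose product is 1.
          have := two_mul_le_add_sq (‖g z.1‖ * ‖z.1‖ / ‖z.2‖) (‖g z.2‖ * ‖z.2‖ / ‖z.1‖)
          have e : 2 * (‖g z.1‖ * ‖z.1‖ / ‖z.2‖) * (‖g z.2‖ * ‖z.2‖ / ‖z.1‖) =
            2 * (‖g z.1‖ * ‖g z.2‖) := by field_simp
          rw [e] at this
          simp only [div_pow, mul_pow] at this
          calc _ ≤ (‖g z.1‖ ^ 2 * ‖z.1‖ ^ 2 / ‖z.2‖ ^ 2 +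
              ‖g z.2‖ ^ 2 * ‖z.2‖ ^ 2 / ‖z.1‖ ^ 2) / 2 := by linarith
            _ = _ := by ring
        calc _ ≤ (‖g z.1‖ ^ 2 * ‖z.1‖ ^ 2 / 2 / ‖z.2‖ ^ 2 +
            ‖g z.2‖ ^ 2 * ‖z.2‖ ^ 2 / 2 / ‖z.1‖ ^ 2) / ‖z.1 - z.2‖ ^ 2 := by gcongr
          _ = _ := by
            simp only [div_eq_mul_inv, mul_inv]
            ring
    _ = (∫⁻ z, G z) + ∫⁻ z, G z := by
        rw [lintegral_add_left hG]
        congr 1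
        exact lintegral_prod_swap (μ := (volume : Measure E3)) (ν := (volume : Measure E3)) G
    _ = _ := by
        rw [hGI, ← add_mul, ← ENNReal.ofReal_add (by positivity) (by positivity), add_halves]

/-! ### Positive-definite kernels built from powers of the inner product -/

/-- Expanding the power over words in the coordinate indices separates the variables, which exhibits
the kernel as a sum of rank-one positive kernels. -/
theorem inner_pow_eq_sum (p q : E3) (n : ℕ) :
    (inner ℝ p q) ^ n = ∑ s : Fin n → Fin 3, (∏ i, p (s i)) * ∏ i, q (s i) := by
  rw [PiLp.inner_apply, Fintype.sum_pow]
  refine Finset.sum_congr rfl fun s _ => ?_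
  rw [← Finset.prod_mul_distrib]
  refine Finset.prod_congr rfl fun i _ => ?_
  simp [mul_comm]

/-- The product of an integrable function and one that is bounded on its support is integrable. -/
theorem integrable_mul_of_bound_on_support {α : Type*} [MeasurableSpace α] {μ : Measure α}
    {G : α → ℂ} (hG : Integrable G μ) {m : α → ℂ} (hm : AEStronglyMeasurable m μ) {C : ℝ}
    (hC : ∀ x, G x ≠ 0 → ‖m x‖ ≤ C) : Integrable (fun x => G x * m x) μ := by
  refine (hG.norm.mul_const C).mono' (hG.1.mul hm) (ae_of_all _ fun x => ?_)
  by_cases hx : G x = 0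
  · simp [hx]
  · rw [norm_mul]
    exact mul_le_mul_of_nonneg_left (hC x hx) (norm_nonneg _)

section PositiveKernel

variable {G : E3 → ℂ} {R : ℝ}

theorem integrable_conj_mul (hG : Integrable G) :
    Integrable (fun z : E3 × E3 => conj (G z.1) * G z.2) := by
  refine Integrable.mul_prod (f := fun p => conj (G p)) ?_ hG
  exact (LinearIsometryEquiv.integrable_comp_iff Complex.conjLIE).2 hG

theorem norm_inner_pow_le (hR : ∀ p, G p ≠ 0 → ‖p‖ ≤ R) (n : ℕ) (z : E3 × E3)
    (hz : conj (G z.1) * G z.2 ≠ 0) : |inner ℝ z.1 z.2| ^ n ≤ (R * R) ^ n := by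
  have h1 : G z.1 ≠ 0 := fun h => hz (by simp [h])
  have h2 : G z.2 ≠ 0 := fun h => hz (by simp [h])
  have := abs_real_inner_le_norm z.1 z.2
  have : |inner ℝ z.1 z.2| ≤ R * R :=
    this.trans (mul_le_mul (hR _ h1) (hR _ h2) (norm_nonneg _) ((norm_nonneg _).trans (hR _ h1)))
  gcongr

theorem integrable_conj_mul_inner_pow (hG : Integrable G) (hR : ∀ p, G p ≠ 0 → ‖p‖ ≤ R) (n : ℕ) :
    Integrable (fun z : E3 × E3 => conj (G z.1) * G z.2 * ((inner ℝ z.1 z.2 ^ n : ℝ) : ℂ)) := by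
  refine integrable_mul_of_bound_on_support (integrable_conj_mul hG) (C := (R * R) ^ n) ?_ ?_
  · exact (Continuous.measurable (by fun_prop)).aestronglyMeasurable
  · intro z hz
    rw [Complex.norm_real, Real.norm_eq_abs, abs_pow]
    exact norm_inner_pow_le hR n z hz

/-- The kernel `⟪p, q⟫ ^ n` is positive. -/
theorem integral_conj_mul_inner_pow_re_nonneg (hG : Integrable G)
    (hR : ∀ p, G p ≠ 0 → ‖p‖ ≤ R) (n : ℕ) :
    0 ≤ (∫ z : E3 × E3, conj (G z.1) * G z.2 * ((inner ℝ z.1 z.2 ^ n : ℝ) : ℂ)).re := by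
  have hi : ∀ s : Fin n → Fin 3, Integrable (fun p : E3 => G p * ((∏ i, p (s i) : ℝ) : ℂ)) := by
    intro s
    refine integrable_mul_of_bound_on_support hG (C := R ^ n) ?_ ?_
    · exact (Continuous.measurable (by fun_prop)).aestronglyMeasurable
    · intro p hp
      rw [Complex.norm_real, Real.norm_eq_abs, Finset.abs_prod]
      calc ∏ i, |p (s i)| ≤ ∏ _i : Fin n, R :=
            Finset.prod_le_prod (fun _ _ => abs_nonneg _) fun i _ =>
              (PiLp.norm_apply_le p (s i)).trans (hR p hp)
        _ = R ^ n := by simp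
  have e : ∀ z : E3 × E3, conj (G z.1) * G z.2 * ((inner ℝ z.1 z.2 ^ n : ℝ) : ℂ) =
      ∑ s : Fin n → Fin 3, conj (G z.1 * ((∏ i, z.1 (s i) : ℝ) : ℂ)) *
        (G z.2 * ((∏ i, z.2 (s i) : ℝ) : ℂ)) := by
    intro z
    rw [inner_pow_eq_sum, Complex.ofReal_sum, Finset.mul_sum]
    refine Finset.sum_congr rfl fun s _ => ?_
    rw [map_mul, Complex.conj_ofReal, Complex.ofReal_mul]
    ring
  simp_rw [e]
  rw [integral_finsetSum _ fun s _ => integrable_conj_mul (hi s), Complex.re_sum]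
  refine Finset.sum_nonneg fun s _ => ?_
  rw [Measure.volume_eq_prod,
    integral_prod_mul (fun p : E3 => conj (G p * ((∏ i, p (s i) : ℝ) : ℂ)))
      -- Each word contributes the squared modulus of a single moment of `G`.
      (fun p : E3 => G p * ((∏ i, p (s i) : ℝ) : ℂ)), integral_conj, ← Complex.normSq_eq_conj_mul_self]
  exact Complex.normSq_nonneg _

/-- A power series in `⟪p, q⟫` with nonnegative coefficients is a positive kernel. -/
theorem integral_conj_mul_hasSum_re_nonneg (hG : Integrable G)
    (hR : ∀ p, G p ≠ 0 → ‖p‖ ≤ R) {c : ℕ → ℝ} (hc : ∀ n, 0 ≤ c n)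
    (hs : ∀ r, 0 ≤ r → Summable fun n => c n * r ^ n) {K : ℝ → ℝ}
    (hK : ∀ x, HasSum (fun n => c n * x ^ n) (K x)) :
    0 ≤ (∫ z : E3 × E3, conj (G z.1) * G z.2 * (K (inner ℝ z.1 z.2) : ℂ)).re := by
  have hi : ∀ n, Integrable (fun z : E3 × E3 => (c n : ℂ) *
      (conj (G z.1) * G z.2 * ((inner ℝ z.1 z.2 ^ n : ℝ) : ℂ))) := fun n =>
    (integrable_conj_mul_inner_pow hG hR n).const_mul _
  -- Bounded support gives |p·q| ≤ R², so the series can be integrated term by term.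
  have hsum : Summable fun n => ∫ z : E3 × E3, ‖(c n : ℂ) *
      (conj (G z.1) * G z.2 * ((inner ℝ z.1 z.2 ^ n : ℝ) : ℂ))‖ := by
    refine Summable.of_nonneg_of_le (fun n => integral_nonneg fun z => norm_nonneg _) (fun n => ?_)
      ((hs (R * R) (mul_self_nonneg R)).mul_left (∫ z : E3 × E3, ‖conj (G z.1) * G z.2‖))
    rw [← integral_mul_const]
    refine integral_mono (hi n).norm ((integrable_conj_mul hG).norm.mul_const _) fun z => ?_
    simp only
    by_cases hz : conj (G z.1) * G z.2 = 0
    · simp [hz]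
    · rw [norm_mul, norm_mul _ ((_ : ℝ) : ℂ), Complex.norm_real, Complex.norm_real, Real.norm_eq_abs,
        Real.norm_eq_abs, abs_pow, abs_of_nonneg (hc n), mul_left_comm]
      exact mul_le_mul_of_nonneg_left (mul_le_mul_of_nonneg_left (norm_inner_pow_le hR n z hz)
        (hc n)) (norm_nonneg _)
  have h := hasSum_integral_of_summable_integral_norm hi hsum
  have e : ∀ z : E3 × E3, ∑' n, (c n : ℂ) *
      (conj (G z.1) * G z.2 * ((inner ℝ z.1 z.2 ^ n : ℝ) : ℂ)) =
      conj (G z.1) * G z.2 * (K (inner ℝ z.1 z.2) : ℂ) := by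
    intro z
    have := ((Complex.hasSum_ofReal.2 (hK (inner ℝ z.1 z.2))).mul_left (conj (G z.1) * G z.2))
    rw [← this.tsum_eq]
    refine tsum_congr fun n => ?_
    push_cast
    ring
  simp_rw [e] at h
  have h2 := Complex.reCLM.hasSum h
  refine h2.nonneg fun n => ?_
  simp only [Complex.reCLM_apply]
  rw [integral_const_mul, Complex.re_ofReal_mul]
  exact mul_nonneg (hc n) (integral_conj_mul_inner_pow_re_nonneg hG hR n)

/-- Positivity of the difference of Gaussian kernels. -/
theorem integral_gaussian_diff_re_nonneg (hG : Integrable G) (hR : ∀ p, G p ≠ 0 → ‖p‖ ≤ R)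
    {t δ : ℝ} (ht : 0 ≤ t) (hδ0 : 0 ≤ δ) (hδ1 : δ ≤ 1) :
    0 ≤ (∫ z : E3 × E3, conj (G z.1) * G z.2 *
      ((Real.exp (-(t * ‖z.1 - z.2‖ ^ 2)) -
        δ * Real.exp (-(t * (‖z.1‖ ^ 2 + ‖z.2‖ ^ 2 + inner ℝ z.1 z.2))) : ℝ) : ℂ)).re := by
  have hexp : ∀ x : ℝ, HasSum (fun n => (n.factorial : ℝ)⁻¹ * x ^ n) (Real.exp x) := fun x => by
    have := NormedSpace.expSeries_div_hasSum_exp (𝔸 := ℝ) x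
    rw [← Real.exp_eq_exp_ℝ] at this
    simpa [div_eq_inv_mul] using this
  -- The factors depending on p or q alone go into the function, leaving a kernel in p·q only.
  set H : E3 → ℂ := fun p => G p * (Real.exp (-(t * ‖p‖ ^ 2)) : ℂ) with hH
  have hHi : Integrable H := by
    refine integrable_mul_of_bound_on_support hG (C := 1) ?_ ?_
    · exact (Continuous.measurable (by fun_prop)).aestronglyMeasurable
    · intro p _
      rw [Complex.norm_real, Real.norm_eq_abs, Real.abs_exp, Real.exp_le_one_iff]
      have : 0 ≤ t * ‖p‖ ^ 2 := by positivity
      linarith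
  have hHR : ∀ p, H p ≠ 0 → ‖p‖ ≤ R := fun p hp => hR p fun h => hp (by simp [hH, h])
  -- Taylor coefficients of exp(2tx) - δ exp(-tx); they are nonnegative because δ(-1)ⁿ ≤ 1 ≤ 2ⁿ.
  set c : ℕ → ℝ := fun n => (n.factorial : ℝ)⁻¹ * (t ^ n * (2 ^ n - δ * (-1) ^ n))
  have hK : ∀ x : ℝ, HasSum (fun n => c n * x ^ n)
      (Real.exp (2 * t * x) - δ * Real.exp (-(t * x))) := fun x => by
    have e : ∀ n : ℕ, c n * x ^ n = (n.factorial : ℝ)⁻¹ * (2 * t * x) ^ n -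
        δ * ((n.factorial : ℝ)⁻¹ * (-(t * x)) ^ n) := fun n => by
      simp only [c]
      rw [neg_eq_neg_one_mul (t * x), mul_pow, mul_pow, mul_pow, mul_pow]
      ring
    simp_rw [e]
    exact (hexp (2 * t * x)).sub ((hexp (-(t * x))).mul_left δ)
  have hc : ∀ n, 0 ≤ c n := fun n => by
    have h1 : (-1 : ℝ) ^ n ≤ 1 := by
      rcases neg_one_pow_eq_or ℝ n with h | h <;> rw [h]; norm_num
    have h2 : (1 : ℝ) ≤ 2 ^ n := one_le_pow₀ (by norm_num)
    have : δ * (-1) ^ n ≤ 2 ^ n := by nlinarith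
    have := sub_nonneg.2 this
    positivity
  have := integral_conj_mul_hasSum_re_nonneg hHi hHR hc (fun r _ => (hK r).summable) hK
  convert this using 3
  ext z
  have e1 : Real.exp (-(t * ‖z.1 - z.2‖ ^ 2)) = Real.exp (-(t * ‖z.1‖ ^ 2)) *
      Real.exp (-(t * ‖z.2‖ ^ 2)) * Real.exp (2 * t * inner ℝ z.1 z.2) := by
    rw [norm_sub_sq_real, ← Real.exp_add, ← Real.exp_add]
    ring_nf
  have e2 : Real.exp (-(t * (‖z.1‖ ^ 2 + ‖z.2‖ ^ 2 + inner ℝ z.1 z.2))) =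
      Real.exp (-(t * ‖z.1‖ ^ 2)) *
      Real.exp (-(t * ‖z.2‖ ^ 2)) * Real.exp (-(t * inner ℝ z.1 z.2)) := by
    rw [← Real.exp_add, ← Real.exp_add]
    ring_nf
  rw [e1, e2]
  simp only [hH, map_mul, Complex.conj_ofReal]
  push_cast
  ring

end PositiveKernel

/-! ### Laplace representation and positivity of the difference kernel -/

/-- The diagonal must be discarded: there 1/|p-q|² takes the default value 0, and the pointwise
comparison of the kernels fails. -/
theorem ae_fst_ne_snd : ∀ᵐ z : E3 × E3, z.1 ≠ z.2 := by
  have hm : MeasurableSet {z : E3 × E3 | z.1 = z.2} :=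
    measurableSet_eq_fun measurable_fst measurable_snd
  have h0 : (volume : Measure (E3 × E3)) {z : E3 × E3 | z.1 = z.2} = 0 := by
    rw [Measure.volume_eq_prod, Measure.measure_prod_null hm]
    refine ae_of_all _ fun x => ?_
    have : Prod.mk x ⁻¹' {z : E3 × E3 | z.1 = z.2} = {x} := by
      ext y; simp [eq_comm]
    simp only [this, measure_singleton, Pi.zero_apply]
  simpa [ae_iff] using h0

theorem integral_Ioi_exp_neg_mul {A : ℝ} (hA : 0 < A) :
    ∫ t in Ioi (0 : ℝ), Real.exp (-(t * A)) = 1 / A := by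
  have := integral_exp_mul_Ioi (neg_lt_zero.2 hA) 0
  rw [mul_zero, Real.exp_zero, neg_div_neg_eq] at this
  rw [← this]
  congr with t
  ring_nf

theorem integrableOn_Ioi_exp_neg_mul {A : ℝ} (hA : 0 < A) :
    IntegrableOn (fun t : ℝ => Real.exp (-(t * A))) (Ioi 0) := by
  convert integrableOn_exp_mul_Ioi (neg_lt_zero.2 hA) 0 using 3
  ring

section Subordination

variable {α : Type*} [MeasurableSpace α] {μ : Measure α} {F : α → ℂ} {A : α → ℝ}

/-- Absolute integrability against 1/A is exactly what Fubini needs, since the t-integral of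
exp(-tA) is 1/A. -/
theorem integrable_mul_exp_neg_prod (hF : Measurable F) (hA : Measurable A)
    (hpos : ∀ᵐ z ∂μ, 0 < A z) (hi : Integrable (fun z => ‖F z‖ / A z) μ) :
    Integrable (fun w : α × ℝ => F w.1 * (Real.exp (-(w.2 * A w.1)) : ℂ))
      (μ.prod (volume.restrict (Ioi 0))) := by
  have hm : Measurable (fun w : α × ℝ => F w.1 * (Real.exp (-(w.2 * A w.1)) : ℂ)) := by fun_prop
  rw [integrable_prod_iff hm.aestronglyMeasurable]
  refine ⟨?_, hi.congr ?_⟩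
  · filter_upwards [hpos] with z hz
    exact (integrableOn_Ioi_exp_neg_mul hz).ofReal.const_mul _
  · filter_upwards [hpos] with z hz
    simp only [norm_mul, Complex.norm_real, Real.norm_eq_abs, Real.abs_exp]
    rw [integral_const_mul, integral_Ioi_exp_neg_mul hz, mul_one_div]

theorem integral_integral_mul_exp_neg [SFinite μ] (hF : Measurable F) (hA : Measurable A)
    (hpos : ∀ᵐ z ∂μ, 0 < A z) (hi : Integrable (fun z => ‖F z‖ / A z) μ) :
    ∫ t in Ioi (0 : ℝ), ∫ z, F z * (Real.exp (-(t * A z)) : ℂ) ∂μ = ∫ z, F z / (A z : ℂ) ∂μ := by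
  rw [← integral_integral_swap (f := fun z t => F z * (Real.exp (-(t * A z)) : ℂ))
    (integrable_mul_exp_neg_prod hF hA hpos hi)]
  refine integral_congr_ae ?_
  filter_upwards [hpos] with z hz
  rw [integral_const_mul, integral_complex_ofReal, integral_Ioi_exp_neg_mul hz]
  simp [div_eq_mul_inv]

end Subordination

/-- The right side minus the left is 3|p+q|² + 4λ. The constant 4 later enters the bound on the
off-diagonal form. -/
theorem norm_sub_sq_le_four_mul {lam : ℝ} (hlam : 0 < lam) (z : E3 × E3) :
    ‖z.1 - z.2‖ ^ 2 < 4 * (‖z.1‖ ^ 2 + ‖z.2‖ ^ 2 + inner ℝ z.1 z.2 + lam) := by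
  have h1 := norm_sub_sq_real z.1 z.2
  have h2 := norm_add_sq_real z.1 z.2
  nlinarith [sq_nonneg ‖z.1 + z.2‖]

theorem off_denom_pos {lam : ℝ} (hlam : 0 < lam) (z : E3 × E3) :
    0 < ‖z.1‖ ^ 2 + ‖z.2‖ ^ 2 + inner ℝ z.1 z.2 + lam := by
  have := norm_sub_sq_le_four_mul hlam z
  nlinarith [sq_nonneg ‖z.1 - z.2‖]

theorem div_off_denom_le {lam : ℝ} (hlam : 0 < lam) {z : E3 × E3} (hz : z.1 ≠ z.2) {x : ℝ}
    (hx : 0 ≤ x) : x / (‖z.1‖ ^ 2 + ‖z.2‖ ^ 2 + inner ℝ z.1 z.2 + lam) ≤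
      4 * (x / ‖z.1 - z.2‖ ^ 2) := by
  have h1 : 0 < ‖z.1 - z.2‖ := norm_pos_iff.2 (sub_ne_zero.2 hz)
  have h2 := norm_sub_sq_le_four_mul hlam z
  have h3 := off_denom_pos hlam z
  rw [mul_div_assoc', div_le_div_iff₀ h3 (by positivity)]
  nlinarith

section KernelDifference

variable {g : E3 → ℂ}

theorem integrable_div_off_denom (hg : Measurable g)
    (hk : Integrable (fun z : E3 × E3 => ‖g z.1‖ * ‖g z.2‖ / ‖z.1 - z.2‖ ^ 2))
    {lam : ℝ} (hlam : 0 < lam) :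
    Integrable (fun z : E3 × E3 =>
      ‖g z.1‖ * ‖g z.2‖ / (‖z.1‖ ^ 2 + ‖z.2‖ ^ 2 + inner ℝ z.1 z.2 + lam)) := by
  refine (hk.const_mul 4).mono' (Measurable.aestronglyMeasurable (by fun_prop)) ?_
  filter_upwards [ae_fst_ne_snd] with z hz
  rw [Real.norm_eq_abs, abs_of_nonneg (div_nonneg (by positivity) (off_denom_pos hlam z).le)]
  exact div_off_denom_le hlam hz (by positivity)

theorem integral_kernel_diff_re_nonneg_of_bounded_support (hg : Measurable g) (hgi : Integrable g)
    {R : ℝ} (hR : ∀ p, g p ≠ 0 → ‖p‖ ≤ R)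
    (hk : Integrable (fun z : E3 × E3 => ‖g z.1‖ * ‖g z.2‖ / ‖z.1 - z.2‖ ^ 2))
    {lam ε : ℝ} (hlam : 0 < lam) (hε0 : 0 ≤ ε) (hε1 : ε ≤ 1) :
    0 ≤ (∫ z : E3 × E3, conj (g z.1) * g z.2 / ((‖z.1 - z.2‖ ^ 2 : ℝ) : ℂ)).re -
      ε * (∫ z : E3 × E3, conj (g z.1) * g z.2 /
        ((‖z.1‖ ^ 2 + ‖z.2‖ ^ 2 + inner ℝ z.1 z.2 + lam : ℝ) : ℂ)).re := by
  set F : E3 × E3 → ℂ := fun z => conj (g z.1) * g z.2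
  have hF : Measurable F := by fun_prop
  have hFn : ∀ z, ‖F z‖ = ‖g z.1‖ * ‖g z.2‖ := fun z => by simp [F]
  have hFi : Integrable F := integrable_conj_mul hgi
  set A : E3 × E3 → ℝ := fun z => ‖z.1 - z.2‖ ^ 2
  set B : E3 × E3 → ℝ := fun z => ‖z.1‖ ^ 2 + ‖z.2‖ ^ 2 + inner ℝ z.1 z.2 + lam
  have hA : Measurable A := by fun_prop
  have hB : Measurable B := by fun_prop
  have hApos : ∀ᵐ z, 0 < A z := by
    filter_upwards [ae_fst_ne_snd] with z hz
    have h1 : 0 < ‖z.1 - z.2‖ := norm_pos_iff.2 (sub_ne_zero.2 hz)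
    positivity
  have hBpos : ∀ᵐ z, 0 < B z := ae_of_all _ fun z => off_denom_pos hlam z
  have hAi : Integrable (fun z => ‖F z‖ / A z) := by simpa only [hFn] using hk
  have hBi : Integrable (fun z => ‖F z‖ / B z) := by
    simpa only [hFn] using integrable_div_off_denom hg hk hlam
  have hIA := (integrable_mul_exp_neg_prod hF hA hApos hAi).integral_prod_right
  have hIB := (integrable_mul_exp_neg_prod hF hB hBpos hBi).integral_prod_right
  rw [← integral_integral_mul_exp_neg hF hA hApos hAi,
    ← integral_integral_mul_exp_neg hF hB hBpos hBi, ← Complex.re_ofReal_mul, ← Complex.sub_re,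
    ← integral_const_mul, ← integral_sub hIA (hIB.const_mul _)]
  -- Moving the real part inside the t-integral reduces the claim to positivity for each fixed t.
  have hre := integral_re (hIA.sub (hIB.const_mul (ε : ℂ)))
  simp only [RCLike.re_to_complex, Pi.sub_apply] at hre
  rw [← hre]
  refine setIntegral_nonneg measurableSet_Ioi fun t ht => ?_
  have ht : 0 < t := ht
  have hexp : ∀ {C : E3 × E3 → ℝ}, Measurable C → (∀ z, 0 ≤ C z) →
      Integrable fun z => F z * (Real.exp (-(t * C z)) : ℂ) := fun {C} hC hC0 => by
    refine hFi.norm.mono' (Measurable.aestronglyMeasurable (by fun_prop)) (ae_of_all _ fun z => ?_)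
    rw [norm_mul, Complex.norm_real, Real.norm_eq_abs, Real.abs_exp]
    refine mul_le_of_le_one_right (norm_nonneg _) (Real.exp_le_one_iff.2 ?_)
    have := mul_nonneg ht.le (hC0 z)
    linarith
  rw [← integral_const_mul, ← integral_sub (hexp hA fun z => by positivity)
    ((hexp hB fun z => (off_denom_pos hlam z).le).const_mul _)]
  have hδ : ε * Real.exp (-(t * lam)) ≤ 1 := by
    have h1 : Real.exp (-(t * lam)) ≤ 1 := by
      rw [Real.exp_le_one_iff]
      have := mul_pos ht hlam
      linarith
    nlinarith [Real.exp_pos (-(t * lam))]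
  -- The λ-dependence of the second Gaussian is only the scalar exp(-tλ), which joins ε in δ.
  have := integral_gaussian_diff_re_nonneg hgi hR ht.le
    (mul_nonneg hε0 (Real.exp_pos (-(t * lam))).le) hδ
  refine this.trans_eq (congrArg Complex.re (integral_congr_ae (ae_of_all _ fun z => ?_)))
  have e : Real.exp (-(t * B z)) = Real.exp (-(t * lam)) *
      Real.exp (-(t * (‖z.1‖ ^ 2 + ‖z.2‖ ^ 2 + inner ℝ z.1 z.2))) := by
    rw [← Real.exp_add]
    simp only [B]
    ring_nf
  simp only [e, F, A]
  push_cast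
  ring

/-- The kernel `1 / ‖p - q‖² - ε / (‖p‖² + ‖q‖² + ⟪p, q⟫ + λ)` is positive for `0 ≤ ε ≤ 1`. -/
theorem integral_kernel_diff_re_nonneg (hg : Measurable g) (hgi : LocallyIntegrable g)
    (hk : Integrable (fun z : E3 × E3 => ‖g z.1‖ * ‖g z.2‖ / ‖z.1 - z.2‖ ^ 2))
    {lam ε : ℝ} (hlam : 0 < lam) (hε0 : 0 ≤ ε) (hε1 : ε ≤ 1) :
    0 ≤ (∫ z : E3 × E3, conj (g z.1) * g z.2 / ((‖z.1 - z.2‖ ^ 2 : ℝ) : ℂ)).re -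
      ε * (∫ z : E3 × E3, conj (g z.1) * g z.2 /
        ((‖z.1‖ ^ 2 + ‖z.2‖ ^ 2 + inner ℝ z.1 z.2 + lam : ℝ) : ℂ)).re := by
  -- Truncation to balls provides the integrability and bounded support needed above; both integrals
  -- then converge by domination by their absolute kernels.
  set gn : ℕ → E3 → ℂ := fun n => (Metric.closedBall (0 : E3) n).indicator g
  have hgn : ∀ n, Measurable (gn n) := fun n => hg.indicator Metric.isClosed_closedBall.measurableSet
  have hle : ∀ n p, ‖gn n p‖ ≤ ‖g p‖ := fun n p => norm_indicator_le_norm_self g p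
  have hlim : ∀ p, ∀ᶠ n in atTop, gn n p = g p := fun p => by
    obtain ⟨N, hN⟩ := exists_nat_ge ‖p‖
    filter_upwards [eventually_ge_atTop N] with n hn
    refine indicator_of_mem ?_ _
    rw [mem_closedBall_zero_iff]
    exact hN.trans (by exact_mod_cast hn)
  have htend : ∀ {C : E3 × E3 → ℝ}, Measurable C → (∀ z, 0 ≤ C z) →
      Integrable (fun z => ‖g z.1‖ * ‖g z.2‖ / C z) →
      Tendsto (fun n => (∫ z : E3 × E3, conj (gn n z.1) * gn n z.2 / (C z : ℂ)).re) atTop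
        (𝓝 (∫ z : E3 × E3, conj (g z.1) * g z.2 / (C z : ℂ)).re) := fun {C} hC hC0 hi => by
    refine (Complex.continuous_re.tendsto _).comp ?_
    refine tendsto_integral_of_dominated_convergence _
      (fun n => Measurable.aestronglyMeasurable ?_) hi
      (fun n => ae_of_all _ fun z => ?_) (ae_of_all _ fun z => ?_)
    · have := hgn n
      fun_prop
    · rw [norm_div, norm_mul, Complex.norm_conj, Complex.norm_real, Real.norm_eq_abs,
        abs_of_nonneg (hC0 z)]
      have := hC0 z
      gcongr <;> apply hle
    · refine tendsto_const_nhds.congr' ?_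
      filter_upwards [hlim z.1, hlim z.2] with n h1 h2
      rw [h1, h2]
  have h1 := htend (C := fun z => ‖z.1 - z.2‖ ^ 2) (by fun_prop) (fun z => by positivity) hk
  have h2 := htend (C := fun z => ‖z.1‖ ^ 2 + ‖z.2‖ ^ 2 + inner ℝ z.1 z.2 + lam) (by fun_prop)
    (fun z => (off_denom_pos hlam z).le) (integrable_div_off_denom hg hk hlam)
  refine ge_of_tendsto' (h1.sub (h2.const_mul ε)) fun n => ?_
  refine integral_kernel_diff_re_nonneg_of_bounded_support (hgn n) ?_ (R := n) ?_ ?_ hlam hε0 hε1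
  · rw [integrable_indicator_iff Metric.isClosed_closedBall.measurableSet]
    exact hgi.integrableOn_isCompact (isCompact_closedBall _ _)
  · intro p hp
    have := mem_of_indicator_ne_zero hp
    rwa [mem_closedBall_zero_iff] at this
  · have := hgn n
    refine hk.mono' (Measurable.aestronglyMeasurable (by fun_prop)) (ae_of_all _ fun z => ?_)
    rw [Real.norm_eq_abs, abs_of_nonneg (by positivity)]
    gcongr <;> apply hle

end KernelDifference

/-! ### Fourier-side weight bound for the Sobolev space -/

theorem toTemperedDistribution_injective : Function.Injective
    (fun f : L2 => (f : 𝓢'(E3, ℂ))) := by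
  have := LinearMap.ker_eq_bot.1
    (Lp.ker_toTemperedDistributionCLM_eq_bot (F := ℂ) (μ := (volume : Measure E3)) (p := 2))
  exact this

theorem smulLeftCLM_rpow_neg_smulLeftCLM_rpow (s : ℝ) (T : 𝓢'(E3, ℂ)) :
    TemperedDistribution.smulLeftCLM ℂ (fun x : E3 ↦ (((1 + ‖x‖ ^ 2) ^ (-s) : ℝ) : ℂ))
      (TemperedDistribution.smulLeftCLM ℂ (fun x : E3 ↦ (((1 + ‖x‖ ^ 2) ^ s : ℝ) : ℂ)) T) = T := by
  rw [TemperedDistribution.smulLeftCLM_smulLeftCLM_apply (by fun_prop) (by fun_prop)]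
  have : ((fun x : E3 ↦ (((1 + ‖x‖ ^ 2) ^ (-s) : ℝ) : ℂ)) *
      fun x : E3 ↦ (((1 + ‖x‖ ^ 2) ^ s : ℝ) : ℂ)) = fun _ => 1 := by
    ext x
    rw [Pi.mul_apply, ← Complex.ofReal_mul, ← Real.rpow_add (by positivity)]
    simp
  rw [mul_comm] at this
  rw [this, TemperedDistribution.smulLeftCLM_const, one_smul]

/-- The Fourier transform of an `H^{1/2}` function, weighted with `‖k‖`, is square integrable. -/
theorem MemHHalf.lintegral_norm_mul_fourier_lt_top {ξ : L2} (h : MemHHalf ξ) :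
    ∫⁻ k : E3, ENNReal.ofReal (‖k‖ * ‖(𝓕 ξ : L2) k‖ ^ 2) < ∞ := by
  obtain ⟨u, hu⟩ := TemperedDistribution.memSobolev_iff_exists_smulLeftCLM_fourier.mp h
  have hb : ∀ x : E3, ‖(((1 + ‖x‖ ^ 2) ^ (-(1 / 2 : ℝ) / 2) : ℝ) : ℂ)‖ ≤ 1 := fun x => by
    rw [Complex.norm_real, Real.norm_eq_abs, abs_eq_self.mpr (by positivity)]
    exact Real.rpow_le_one_of_one_le_of_nonpos (by simp) (by norm_num)
  have hw : MemLp (fun x : E3 ↦ (((1 + ‖x‖ ^ 2) ^ (-(1 / 2 : ℝ) / 2) : ℝ) : ℂ)) ∞ := by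
    refine memLp_top_of_bound ?_ 1 (ae_of_all _ hb)
    have : (fun x : E3 ↦ (((1 + ‖x‖ ^ 2) ^ (-(1 / 2 : ℝ) / 2) : ℝ) : ℂ)).HasTemperateGrowth := by
      fun_prop
    exact this.1.continuous.aestronglyMeasurable
  -- Undoing the Bessel multiplier: the identity holds for tempered distributions and descends to L²
  -- by injectivity of the embedding.
  have e : (𝓕 ξ : L2) = hw.toLp • u := by
    apply toTemperedDistribution_injective
    simp only
    rw [MeasureTheory.Lp.toTemperedDistribution_smul_eq (by fun_prop), ← hu, neg_div,
      smulLeftCLM_rpow_neg_smulLeftCLM_rpow, Lp.fourier_toTemperedDistribution_eq]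
  have hu2 : ∫⁻ k : E3, ‖u k‖ₑ ^ 2 < ∞ := by
    have := (Lp.memLp u).eLpNorm_lt_top
    rw [eLpNorm_lt_top_iff_lintegral_rpow_enorm_lt_top (by norm_num) (by norm_num)] at this
    simpa using this
  refine lt_of_le_of_lt (lintegral_mono_ae ?_) hu2
  have hae : (𝓕 ξ : L2) =ᵐ[volume] fun k =>
      (((1 + ‖k‖ ^ 2) ^ (-(1 / 2 : ℝ) / 2) : ℝ) : ℂ) * u k := by
    rw [e]
    filter_upwards [Lp.coeFn_lpSMul (r := 2) hw.toLp u, hw.coeFn_toLp] with k h1 h2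
    rw [h1, Pi.smul_apply', h2, smul_eq_mul]
  filter_upwards [hae] with k hk
  rw [hk, norm_mul, Complex.norm_real, Real.norm_eq_abs, abs_eq_self.mpr (by positivity),
    ← ofReal_norm, ← ENNReal.ofReal_pow (by positivity)]
  refine ENNReal.ofReal_le_ofReal ?_
  rw [mul_pow, ← Real.rpow_natCast, ← Real.rpow_mul (by positivity), ← mul_assoc]
  -- The squared weight is (1+|k|²)^(-1/2), which absorbs exactly one power of |k|.
  have : ‖k‖ * (1 + ‖k‖ ^ 2) ^ (-(1 / 2 : ℝ) / 2 * (2 : ℕ)) ≤ 1 := by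
    rw [show (-(1 / 2 : ℝ) / 2 * (2 : ℕ)) = -(1/2) by norm_num, Real.rpow_neg (by positivity),
      ← Real.sqrt_eq_rpow, ← div_eq_mul_inv, div_le_one (by positivity)]
    exact Real.le_sqrt_of_sq_le (by linarith)
  calc _ ≤ 1 * ‖u k‖ ^ 2 := by gcongr
    _ = _ := one_mul _

/-! ### The symbol of the Gagliardo seminorm -/

/-- Writes the singular kernel as a superposition of Gaussians. The parameter is s² rather than t so
that the s³ here cancels the s⁻³ of a Gaussian integral in dimension three. -/
theorem lintegral_Ioi_pow_three_mul_exp {r : ℝ} (hr : 0 < r) :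
    ∫⁻ s in Ioi (0 : ℝ), ENNReal.ofReal (2 * s ^ 3 * Real.exp (-(s ^ 2 * r ^ 2))) =
      ENNReal.ofReal (1 / r ^ 4) := by
  set g : ℝ → ℝ := fun s => -((s ^ 2 * r ^ 2 + 1) * Real.exp (-(s ^ 2 * r ^ 2)) / r ^ 4)
  have hd : ∀ s : ℝ, HasDerivAt g (2 * s ^ 3 * Real.exp (-(s ^ 2 * r ^ 2))) s := fun s => by
    have h1 : HasDerivAt (fun s : ℝ => s ^ 2 * r ^ 2) (2 * s * r ^ 2) s := by
      simpa using (hasDerivAt_pow 2 s).mul_const (r ^ 2)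
    refine (((h1.add_const 1).mul h1.neg.exp).div_const (r ^ 4)).neg.congr_deriv ?_
    simp only [Pi.neg_apply]
    field_simp
    ring
  have ht : Tendsto g atTop (𝓝 0) := by
    have hu : Tendsto (fun s : ℝ => s ^ 2 * r ^ 2) atTop atTop :=
      (tendsto_pow_atTop two_ne_zero).atTop_mul_const (by positivity)
    have h1 : Tendsto (fun u : ℝ => -((u + 1) * Real.exp (-u) / r ^ 4)) atTop (𝓝 0) := by
      have := ((Real.tendsto_pow_mul_exp_neg_atTop_nhds_zero 1).add
        (Real.tendsto_pow_mul_exp_neg_atTop_nhds_zero 0)).div_const (r ^ 4)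
      convert this.neg using 2
      · ring
      · simp
    exact h1.comp hu
  rw [lintegral_Ioi_deriv_of_nonneg (hd 0).continuousAt.continuousWithinAt (fun s _ => hd s) ?_ ht]
  · congr 1
    simp [g]
  · intro s hs
    have : 0 < s := hs
    positivity

theorem lintegral_Ioi_inv_sq_mul_exp {b : ℝ} (hb : 0 < b) :
    ∫⁻ s in Ioi (0 : ℝ), ENNReal.ofReal (1 / s ^ 2 * Real.exp (-(b / s ^ 2))) =
      ENNReal.ofReal (√(Real.pi / b) / 2) := by
  -- The substitution s ↦ 1/s turns the integrand into an ordinary Gaussian.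
  have e : EqOn (fun s : ℝ => (|(-1 : ℝ)| * s ^ ((-1 : ℝ) - 1)) •
      Real.exp (-b * (s ^ (-1 : ℝ)) ^ 2)) (fun s => 1 / s ^ 2 * Real.exp (-(b / s ^ 2)))
      (Ioi 0) := fun s hs => by
    have hs : 0 < s := hs
    simp only [smul_eq_mul]
    rw [show ((-1 : ℝ) - 1) = -(2 : ℕ) by norm_num, Real.rpow_neg hs.le, Real.rpow_natCast,
      Real.rpow_neg_one, abs_neg, abs_one]
    congr 1
    · field_simp
  have hi : IntegrableOn (fun s : ℝ => 1 / s ^ 2 * Real.exp (-(b / s ^ 2))) (Ioi 0) := by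
    rw [← integrableOn_congr_fun e measurableSet_Ioi, integrableOn_Ioi_comp_rpow_iff
      (fun u => Real.exp (-b * u ^ 2)) (by norm_num)]
    exact (integrable_exp_neg_mul_sq hb).integrableOn
  rw [← ofReal_integral_eq_lintegral_ofReal hi, ← setIntegral_congr_fun measurableSet_Ioi e,
    integral_comp_rpow_Ioi (fun u => Real.exp (-b * u ^ 2)) (by norm_num), integral_gaussian_Ioi]
  exact ae_of_all _ fun s => by positivity

/-- The integrand is itself an integral over b from 0 to a of s⁻² exp(-b/s²). Swapping by Tonelli
leaves √π/(2√b), an exact derivative. -/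
theorem lintegral_Ioi_one_sub_exp {a : ℝ} (ha : 0 ≤ a) :
    ∫⁻ s in Ioi (0 : ℝ), ENNReal.ofReal (1 - Real.exp (-(a / s ^ 2))) =
      ENNReal.ofReal √(Real.pi * a) := by
  calc ∫⁻ s in Ioi (0 : ℝ), ENNReal.ofReal (1 - Real.exp (-(a / s ^ 2)))
      = ∫⁻ s in Ioi (0 : ℝ), ∫⁻ b in Ioo (0 : ℝ) a,
          ENNReal.ofReal (1 / s ^ 2 * Real.exp (-(b / s ^ 2))) := by
        refine setLIntegral_congr_fun measurableSet_Ioi fun s hs => ?_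
        have hs : 0 < s := hs
        rw [lintegral_Ioo_deriv_of_nonneg (g := fun b => -Real.exp (-(b / s ^ 2))) ha
          (by fun_prop) (fun b _ => ?_) fun b _ => by positivity]
        · congr 1
          simp
          ring
        · refine ((hasDerivAt_id b).div_const (s ^ 2)).neg.exp.neg.congr_deriv ?_
          simp
          ring
    _ = ∫⁻ b in Ioo (0 : ℝ) a, ∫⁻ s in Ioi (0 : ℝ),
          ENNReal.ofReal (1 / s ^ 2 * Real.exp (-(b / s ^ 2))) := by
        rw [lintegral_lintegral_swap]
        apply Measurable.aemeasurable
        unfold Function.uncurry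
        fun_prop
    _ = ∫⁻ b in Ioo (0 : ℝ) a, ENNReal.ofReal (√Real.pi * (1 / (2 * √b))) := by
        refine setLIntegral_congr_fun measurableSet_Ioo fun b hb => ?_
        rw [lintegral_Ioi_inv_sq_mul_exp hb.1, Real.sqrt_div Real.pi_pos.le]
        congr 1
        field_simp
    _ = ENNReal.ofReal √(Real.pi * a) := by
        rw [lintegral_Ioo_deriv_of_nonneg (g := fun b => √Real.pi * √b) ha (by fun_prop)
          (fun b hb => (Real.hasDerivAt_sqrt hb.1.ne').const_mul _) fun b _ => by positivity]
        simp [Real.sqrt_mul Real.pi_pos.le]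

/-- The complex Gaussian integral with linear term c (p·h) is taken at c = 0 and c = i; the
difference of real parts is the result. -/
theorem lintegral_one_sub_cos_mul_gaussian (p : E3) {s : ℝ} (hs : 0 < s) :
    ∫⁻ h : E3, ENNReal.ofReal ((1 - Real.cos (inner ℝ p h)) * Real.exp (-(s ^ 2 * ‖h‖ ^ 2))) =
      ENNReal.ofReal (√Real.pi ^ 3 / s ^ 3 * (1 - Real.exp (-(‖p‖ ^ 2 / 4 / s ^ 2)))) := by
  have hs2 : 0 < s ^ 2 := by positivity
  have hre : ((s ^ 2 : ℝ) : ℂ).re = s ^ 2 := Complex.ofReal_re _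
  have hsqrt : ((Real.pi : ℂ) / ((s ^ 2 : ℝ) : ℂ)) ^ ((Module.finrank ℝ E3 : ℂ) / 2) =
      ((√Real.pi ^ 3 / s ^ 3 : ℝ) : ℂ) := by
    rw [← Complex.ofReal_div, finrank_euclideanSpace, Fintype.card_fin]
    have : ((3 : ℕ) : ℂ) / 2 = ((3 / 2 : ℝ) : ℂ) := by push_cast; ring
    rw [this, ← Complex.ofReal_cpow (by positivity)]
    congr 1
    rw [show (3 / 2 : ℝ) = 1 / 2 * (3 : ℕ) by norm_num, Real.rpow_mul (by positivity),
      ← Real.sqrt_eq_rpow, Real.sqrt_div Real.pi_pos.le, Real.sqrt_sq hs.le, Real.rpow_natCast,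
      div_pow]
  have hint : ∀ c : ℂ, ∫ h : E3, Complex.exp (-((s ^ 2 : ℝ) : ℂ) * ‖h‖ ^ 2 + c * inner ℝ p h) =
      ((√Real.pi ^ 3 / s ^ 3 : ℝ) : ℂ) * Complex.exp (c ^ 2 * ‖p‖ ^ 2 / (4 * ((s ^ 2 : ℝ) : ℂ))) :=
    fun c => by
      rw [GaussianFourier.integral_cexp_neg_mul_sq_norm_add (by rw [hre]; exact hs2) c p, hsqrt]
  have hI : ∀ c : ℂ, Integrable fun h : E3 =>
      Complex.exp (-((s ^ 2 : ℝ) : ℂ) * ‖h‖ ^ 2 + c * inner ℝ p h) := fun c =>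
    GaussianFourier.integrable_cexp_neg_mul_sq_norm_add (by rw [hre]; exact hs2) c p
  have hpt : ∀ h : E3, (1 - Real.cos (inner ℝ p h)) * Real.exp (-(s ^ 2 * ‖h‖ ^ 2)) =
      (Complex.exp (-((s ^ 2 : ℝ) : ℂ) * ‖h‖ ^ 2 + 0 * inner ℝ p h) -
        Complex.exp (-((s ^ 2 : ℝ) : ℂ) * ‖h‖ ^ 2 + Complex.I * inner ℝ p h)).re := fun h => by
    rw [Complex.exp_add, Complex.exp_add, zero_mul, Complex.exp_zero,
      show -((s ^ 2 : ℝ) : ℂ) * ‖h‖ ^ 2 = ((-(s ^ 2 * ‖h‖ ^ 2) : ℝ) : ℂ) by push_cast; ring,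
      ← Complex.ofReal_exp, ← mul_sub, Complex.re_ofReal_mul, mul_comm Complex.I, Complex.sub_re,
      Complex.exp_ofReal_mul_I_re, Complex.one_re]
    ring
  have hsub := (hI 0).sub (hI Complex.I)
  have hR : Integrable fun h : E3 =>
      (1 - Real.cos (inner ℝ p h)) * Real.exp (-(s ^ 2 * ‖h‖ ^ 2)) := by
    simp_rw [hpt]
    exact hsub.re
  rw [← ofReal_integral_eq_lintegral_ofReal hR (ae_of_all _ fun h =>
    mul_nonneg (sub_nonneg.2 (Real.cos_le_one _)) (Real.exp_pos _).le)]
  congr 1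
  simp_rw [hpt]
  have := integral_re hsub
  simp only [RCLike.re_to_complex, Pi.sub_apply] at this
  rw [this, integral_sub (hI 0) (hI Complex.I), hint, hint, ← mul_sub, Complex.re_ofReal_mul]
  congr 1
  rw [Complex.I_sq, show -1 * (‖p‖ : ℂ) ^ 2 / (4 * ((s ^ 2 : ℝ) : ℂ)) =
    ((-(‖p‖ ^ 2 / 4 / s ^ 2) : ℝ) : ℂ) by push_cast; field_simp, ← Complex.ofReal_exp]
  simp [Complex.sub_re, Complex.ofReal_re, -Complex.ofReal_exp]

/-- The symbol of the Gagliardo seminorm. -/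
theorem lintegral_one_sub_cos_div_norm_pow_four (p : E3) :
    ∫⁻ h : E3, ENNReal.ofReal (2 * (1 - Real.cos (inner ℝ p h)) / ‖h‖ ^ 4) =
      ENNReal.ofReal (2 * Real.pi ^ 2 * ‖p‖) := by
  have hcos : ∀ h : E3, 0 ≤ 1 - Real.cos (inner ℝ p h) := fun h => sub_nonneg.2 (Real.cos_le_one _)
  calc ∫⁻ h : E3, ENNReal.ofReal (2 * (1 - Real.cos (inner ℝ p h)) / ‖h‖ ^ 4)
      = ∫⁻ h : E3, ∫⁻ s in Ioi (0 : ℝ), ENNReal.ofReal (2 * (1 - Real.cos (inner ℝ p h))) *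
          ENNReal.ofReal (2 * s ^ 3 * Real.exp (-(s ^ 2 * ‖h‖ ^ 2))) := by
        refine lintegral_congr_ae ?_
        filter_upwards [Measure.ae_ne volume (0 : E3)] with h hh
        rw [lintegral_const_mul' _ _ ENNReal.ofReal_ne_top,
          lintegral_Ioi_pow_three_mul_exp (norm_pos_iff.2 hh),
          ← ENNReal.ofReal_mul (mul_nonneg zero_le_two (hcos h)), mul_one_div]
    _ = ∫⁻ s in Ioi (0 : ℝ), ∫⁻ h : E3, ENNReal.ofReal (2 * (1 - Real.cos (inner ℝ p h))) *
          ENNReal.ofReal (2 * s ^ 3 * Real.exp (-(s ^ 2 * ‖h‖ ^ 2))) := by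
        rw [lintegral_lintegral_swap]
        apply Measurable.aemeasurable
        unfold Function.uncurry
        fun_prop
    _ = ∫⁻ s in Ioi (0 : ℝ), ENNReal.ofReal (4 * √Real.pi ^ 3) *
          ENNReal.ofReal (1 - Real.exp (-(‖p‖ ^ 2 / 4 / s ^ 2))) := by
        refine setLIntegral_congr_fun measurableSet_Ioi fun s hs => ?_
        have hs : 0 < s := hs
        have e : ∀ h : E3, ENNReal.ofReal (2 * (1 - Real.cos (inner ℝ p h))) *
            ENNReal.ofReal (2 * s ^ 3 * Real.exp (-(s ^ 2 * ‖h‖ ^ 2))) =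
            ENNReal.ofReal (4 * s ^ 3) * ENNReal.ofReal
              ((1 - Real.cos (inner ℝ p h)) * Real.exp (-(s ^ 2 * ‖h‖ ^ 2))) := fun h => by
          rw [← ENNReal.ofReal_mul (mul_nonneg zero_le_two (hcos h)),
            ← ENNReal.ofReal_mul (by positivity)]
          ring_nf
        simp only [e]
        rw [lintegral_const_mul' _ _ ENNReal.ofReal_ne_top,
          lintegral_one_sub_cos_mul_gaussian p hs, ← ENNReal.ofReal_mul (by positivity),
          ← ENNReal.ofReal_mul (by positivity)]
        congr 1
        field_simp
    _ = ENNReal.ofReal (2 * Real.pi ^ 2 * ‖p‖) := by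
        rw [lintegral_const_mul' _ _ ENNReal.ofReal_ne_top,
          lintegral_Ioi_one_sub_exp (by positivity), ← ENNReal.ofReal_mul (by positivity)]
        congr 1
        rw [Real.sqrt_mul Real.pi_pos.le, show ‖p‖ ^ 2 / 4 = (‖p‖ / 2) ^ 2 by ring,
          Real.sqrt_sq (by positivity)]
        have : √Real.pi ^ 4 = Real.pi ^ 2 := by
          rw [show √Real.pi ^ 4 = (√Real.pi ^ 2) ^ 2 by ring, Real.sq_sqrt Real.pi_pos.le]
        calc _ = 2 * √Real.pi ^ 4 * ‖p‖ := by ring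
          _ = _ := by rw [this]

/-! ### Translations, phases and Plancherel -/

/-- Translation by `a` on `L²`. -/
noncomputable def translate (a : E3) (u : L2) : L2 :=
  Lp.compMeasurePreserving (fun x : E3 => x - a) (measurePreserving_sub_right volume a) u

theorem coeFn_translate (a : E3) (u : L2) : translate a u =ᵐ[volume] fun x => u (x - a) :=
  Lp.coeFn_compMeasurePreserving u (measurePreserving_sub_right volume a)

theorem continuous_translate (a : E3) : Continuous (translate a) :=
  (Lp.isometry_compMeasurePreserving (measurePreserving_sub_right volume a)).continuous

theorem memLp_top_phase (a : E3) :
    MemLp (fun k : E3 => Complex.exp (((-2 * Real.pi * inner ℝ a k : ℝ) : ℂ) * Complex.I)) ∞ := by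
  refine memLp_top_of_bound (Continuous.aestronglyMeasurable (by fun_prop)) 1
    (ae_of_all _ fun k => ?_)
  rw [Complex.norm_exp_ofReal_mul_I]

theorem coeFn_phase_smul (a : E3) (u : L2) :
    ((memLp_top_phase a).toLp • u : L2) =ᵐ[volume] fun k =>
      Complex.exp (((-2 * Real.pi * inner ℝ a k : ℝ) : ℂ) * Complex.I) * u k := by
  filter_upwards [Lp.coeFn_lpSMul (r := 2) (memLp_top_phase a).toLp u,
    (memLp_top_phase a).coeFn_toLp] with k h1 h2
  rw [h1, Pi.smul_apply', h2, smul_eq_mul]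

theorem continuous_phase_smul (a : E3) :
    Continuous fun u : L2 => ((memLp_top_phase a).toLp • u : L2) := by
  refine AddMonoidHomClass.continuous_of_bound
    (AddMonoidHom.mk' (fun u : L2 => ((memLp_top_phase a).toLp • u : L2))
      fun u v => Lp.add_smul _ u v) ‖(memLp_top_phase a).toLp‖ fun u => ?_
  exact Lp.norm_smul_le _ u

/-- The `L²` Fourier transform turns translations into phases. -/
theorem fourier_translate (a : E3) (u : L2) :
    (𝓕 (translate a u) : L2) = (memLp_top_phase a).toLp • (𝓕 u : L2) := by
  have hcF : Continuous (fun u : L2 => (𝓕 u : L2)) :=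
    ContinuousFourier.continuous_fourier
  -- Both sides are continuous in u, so it suffices to treat Schwartz functions, where the transform
  -- is an honest integral and a shift of variables applies.
  refine (SchwartzMap.denseRange_toLpCLM (E := E3) (F := ℂ) (p := 2) (μ := volume)
    (by norm_num)).induction_on (p := fun u : L2 =>
      (𝓕 (translate a u) : L2) = (memLp_top_phase a).toLp • (𝓕 u : L2)) u ?_ ?_
  · exact isClosed_eq (hcF.comp (continuous_translate a)) ((continuous_phase_smul a).comp hcF)
  · intro f
    rw [SchwartzMap.toLpCLM_apply]
    have h1 : translate a (f.toLp 2) = (f.compSubConstCLM ℂ a).toLp 2 := by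
      apply Lp.ext
      filter_upwards [coeFn_translate a (f.toLp 2), (f.compSubConstCLM ℂ a).coeFn_toLp 2 volume,
        (measurePreserving_sub_right volume a).quasiMeasurePreserving.ae
          (f.coeFn_toLp 2 volume)] with x h1 h2 h3
      rw [h1, h2, h3, SchwartzMap.compSubConstCLM_apply]
    rw [h1, SchwartzMap.toLp_fourier_eq, SchwartzMap.toLp_fourier_eq]
    apply Lp.ext
    filter_upwards [coeFn_phase_smul a ((𝓕 f).toLp 2), (𝓕 f).coeFn_toLp 2 volume,
      (𝓕 (f.compSubConstCLM ℂ a)).coeFn_toLp 2 volume] with k h1 h2 h3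
    rw [h1, h2, h3, SchwartzMap.fourier_coe, SchwartzMap.fourier_coe, Real.fourier_eq',
      Real.fourier_eq', ← integral_const_mul,
      ← integral_sub_right_eq_self (fun x => Complex.exp
        (((-2 * Real.pi * inner ℝ a k : ℝ) : ℂ) * Complex.I) *
          (Complex.exp (((-2 * Real.pi * inner ℝ x k : ℝ) : ℂ) * Complex.I) • f x)) a]
    refine integral_congr_ae (ae_of_all _ fun x => ?_)
    simp only [SchwartzMap.compSubConstCLM_apply, smul_eq_mul]
    rw [← mul_assoc, ← Complex.exp_add, inner_sub_left]
    congr 2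
    push_cast
    ring

theorem lintegral_norm_sq_eq (u : L2) :
    ∫⁻ x : E3, ENNReal.ofReal (‖u x‖ ^ 2) = ENNReal.ofReal (‖u‖ ^ 2) := by
  rw [ENNReal.ofReal_pow (norm_nonneg _), ofReal_norm, Lp.enorm_def,
    eLpNorm_eq_lintegral_rpow_enorm_toReal (by norm_num) (by norm_num)]
  rw [← ENNReal.rpow_natCast, ← ENNReal.rpow_mul]
  simp [← ofReal_norm, ENNReal.ofReal_pow]

/-- Plancherel for u - u(· - a), whose transform carries the factor 1 - exp(-iθ) with |1 -
exp(-iθ)|² = 2(1 - cos θ). -/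
theorem lintegral_norm_sub_translate_sq (a : E3) (u : L2) :
    ∫⁻ x : E3, ENNReal.ofReal (‖u x - u (x - a)‖ ^ 2) =
      ∫⁻ k : E3, ENNReal.ofReal (2 * (1 - Real.cos (inner ℝ ((2 * Real.pi) • k) a)) *
        ‖(𝓕 u : L2) k‖ ^ 2) := by
  calc ∫⁻ x : E3, ENNReal.ofReal (‖u x - u (x - a)‖ ^ 2)
      = ∫⁻ x : E3, ENNReal.ofReal (‖(u - translate a u : L2) x‖ ^ 2) := by
        refine lintegral_congr_ae ?_
        filter_upwards [Lp.coeFn_sub u (translate a u), coeFn_translate a u] with x h1 h2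
        rw [h1, Pi.sub_apply, h2]
    _ = ∫⁻ k : E3, ENNReal.ofReal
          (‖((𝓕 u : L2) - (memLp_top_phase a).toLp • (𝓕 u : L2) : L2) k‖ ^ 2) := by
        rw [lintegral_norm_sq_eq, lintegral_norm_sq_eq, ← fourier_translate,
          ← FourierTransform.fourierCLM_apply (R := ℂ),
          ← FourierTransform.fourierCLM_apply (R := ℂ), ← map_sub, FourierTransform.fourierCLM_apply,
          Lp.norm_fourier_eq]
    _ = _ := by
        refine lintegral_congr_ae ?_
        filter_upwards [Lp.coeFn_sub (𝓕 u : L2) ((memLp_top_phase a).toLp • (𝓕 u : L2)),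
          coeFn_phase_smul a (𝓕 u : L2)] with k h1 h2
        rw [h1, Pi.sub_apply, h2]
        congr 1
        rw [← one_sub_mul, norm_mul, mul_pow]
        congr 1
        rw [← Complex.normSq_eq_norm_sq, Complex.normSq_apply, Complex.sub_re, Complex.sub_im,
          Complex.exp_ofReal_mul_I_re, Complex.exp_ofReal_mul_I_im, real_inner_smul_left,
          real_inner_comm a k, neg_mul, neg_mul, Real.cos_neg, Real.sin_neg]
        simp only [Complex.one_re, Complex.one_im]
        nlinarith [Real.sin_sq_add_cos_sq (2 * Real.pi * inner ℝ a k)]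

/-- The Gagliardo seminorm in Fourier space. -/
theorem lintegral_gagliardoIntegrand (u : L2) :
    ∫⁻ z : E3 × E3, ENNReal.ofReal (gagliardoIntegrand u z) =
      ENNReal.ofReal (4 * Real.pi ^ 3) *
        ∫⁻ k : E3, ENNReal.ofReal (‖k‖ * ‖(𝓕 u : L2) k‖ ^ 2) := by
  have hu : Measurable u := (Lp.stronglyMeasurable u).measurable
  have hFu : Measurable (𝓕 u : L2) := (Lp.stronglyMeasurable (𝓕 u : L2)).measurable
  calc ∫⁻ z : E3 × E3, ENNReal.ofReal (gagliardoIntegrand u z)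
      = ∫⁻ x : E3, ∫⁻ a : E3, ENNReal.ofReal (1 / ‖a‖ ^ 4) *
          ENNReal.ofReal (‖u x - u (x - a)‖ ^ 2) := by
        rw [Measure.volume_eq_prod, lintegral_prod _ (Measurable.aemeasurable (by
          unfold gagliardoIntegrand; fun_prop))]
        refine lintegral_congr fun x => ?_
        -- For fixed x, the second variable is replaced by x - a, so the kernel depends on a alone.
        rw [← lintegral_sub_left_eq_self _ x]
        refine lintegral_congr fun a => ?_
        rw [← ENNReal.ofReal_mul (by positivity), gagliardoIntegrand, sub_sub_cancel,
          one_div_mul_eq_div]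
    _ = ∫⁻ a : E3, ENNReal.ofReal (1 / ‖a‖ ^ 4) *
          ∫⁻ x : E3, ENNReal.ofReal (‖u x - u (x - a)‖ ^ 2) := by
        rw [lintegral_lintegral_swap]
        · refine lintegral_congr fun a => ?_
          rw [lintegral_const_mul' _ _ ENNReal.ofReal_ne_top]
        · apply Measurable.aemeasurable
          unfold Function.uncurry
          fun_prop
    _ = ∫⁻ a : E3, ∫⁻ k : E3, ENNReal.ofReal (‖(𝓕 u : L2) k‖ ^ 2) * ENNReal.ofReal
          (2 * (1 - Real.cos (inner ℝ ((2 * Real.pi) • k) a)) / ‖a‖ ^ 4) := by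
        refine lintegral_congr fun a => ?_
        rw [lintegral_norm_sub_translate_sq, ← lintegral_const_mul' _ _ ENNReal.ofReal_ne_top]
        refine lintegral_congr fun k => ?_
        rw [← ENNReal.ofReal_mul (by positivity), ← ENNReal.ofReal_mul (by positivity)]
        ring_nf
    _ = ∫⁻ k : E3, ∫⁻ a : E3, ENNReal.ofReal (‖(𝓕 u : L2) k‖ ^ 2) * ENNReal.ofReal
          (2 * (1 - Real.cos (inner ℝ ((2 * Real.pi) • k) a)) / ‖a‖ ^ 4) := by
        rw [lintegral_lintegral_swap]
        apply Measurable.aemeasurable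
        unfold Function.uncurry
        fun_prop
    _ = _ := by
        -- The symbol is evaluated at 2πk, hence the constant 2π² · 2π = 4π³.
        rw [← lintegral_const_mul' _ _ ENNReal.ofReal_ne_top]
        refine lintegral_congr fun k => ?_
        rw [lintegral_const_mul' _ _ ENNReal.ofReal_ne_top,
          lintegral_one_sub_cos_div_norm_pow_four, norm_smul, Real.norm_eq_abs,
          abs_of_pos Real.two_pi_pos, ← ENNReal.ofReal_mul (by positivity),
          ← ENNReal.ofReal_mul (by positivity)]
        ring_nf

/-! ### Passing to the unitary normalization -/

theorem measurable_hat (ξ : L2) : Measurable (hat ξ) := by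
  have : Measurable (𝓕 ξ : L2) := (Lp.stronglyMeasurable (𝓕 ξ : L2)).measurable
  unfold hat
  fun_prop

theorem norm_hat_sq (ξ : L2) (p : E3) :
    ‖hat ξ p‖ ^ 2 = ((2 * Real.pi) ^ 3)⁻¹ * ‖(𝓕 ξ : L2) ((2 * Real.pi)⁻¹ • p)‖ ^ 2 := by
  have h := Real.two_pi_pos
  rw [hat, norm_mul, mul_pow, Complex.norm_real, Real.norm_eq_abs, sq_abs, ← Real.rpow_natCast,
    ← Real.rpow_mul h.le, show (-(3 / 2) : ℝ) * (2 : ℕ) = -(3 : ℕ) by norm_num,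
    Real.rpow_neg h.le, Real.rpow_natCast]

theorem lintegral_comp_inv_two_pi_smul {f : E3 → ℝ≥0∞} (hf : Measurable f) :
    ∫⁻ p : E3, f ((2 * Real.pi)⁻¹ • p) = ENNReal.ofReal ((2 * Real.pi) ^ 3) * ∫⁻ k, f k := by
  have h := Real.two_pi_pos
  have hm : Measurable fun p : E3 => (2 * Real.pi)⁻¹ • p := measurable_const_smul _
  rw [← lintegral_map hf hm, Measure.map_addHaar_smul volume (inv_ne_zero h.ne'),
    lintegral_smul_measure, finrank_euclideanSpace, Fintype.card_fin, inv_pow, inv_inv,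
    abs_of_pos (by positivity), smul_eq_mul]

theorem lintegral_norm_hat_sq (ξ : L2) :
    ∫⁻ p : E3, ENNReal.ofReal (‖hat ξ p‖ ^ 2) = ENNReal.ofReal (‖ξ‖ ^ 2) := by
  have h := Real.two_pi_pos
  have hF : Measurable (𝓕 ξ : L2) := (Lp.stronglyMeasurable (𝓕 ξ : L2)).measurable
  simp_rw [norm_hat_sq]
  rw [lintegral_comp_inv_two_pi_smul (f := fun k =>
      ENNReal.ofReal (((2 * Real.pi) ^ 3)⁻¹ * ‖(𝓕 ξ : L2) k‖ ^ 2)) (by fun_prop),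
    ← lintegral_const_mul' _ _ ENNReal.ofReal_ne_top, ← Lp.norm_fourier_eq ξ,
    ← lintegral_norm_sq_eq]
  refine lintegral_congr fun k => ?_
  rw [← ENNReal.ofReal_mul (by positivity), mul_inv_cancel_left₀ (by positivity)]

/-- The Jacobian (2π)³ cancels the normalization of `hat`; the factor left over is |p| = 2π|k|. -/
theorem lintegral_norm_mul_norm_hat_sq (ξ : L2) :
    ∫⁻ p : E3, ENNReal.ofReal (‖p‖ * ‖hat ξ p‖ ^ 2) =
      ENNReal.ofReal (2 * Real.pi) * ∫⁻ k : E3, ENNReal.ofReal (‖k‖ * ‖(𝓕 ξ : L2) k‖ ^ 2) := by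
  have h := Real.two_pi_pos
  have hF : Measurable (𝓕 ξ : L2) := (Lp.stronglyMeasurable (𝓕 ξ : L2)).measurable
  have e : ∀ p : E3, ‖p‖ * ‖hat ξ p‖ ^ 2 = (2 * Real.pi) * ((2 * Real.pi) ^ 3)⁻¹ *
      (‖(2 * Real.pi)⁻¹ • p‖ * ‖(𝓕 ξ : L2) ((2 * Real.pi)⁻¹ • p)‖ ^ 2) := fun p => by
    rw [norm_hat_sq, norm_smul, norm_inv, Real.norm_eq_abs, abs_of_pos h]
    field_simp
  simp_rw [e]
  rw [lintegral_comp_inv_two_pi_smul (f := fun k => ENNReal.ofReal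
      ((2 * Real.pi) * ((2 * Real.pi) ^ 3)⁻¹ * (‖k‖ * ‖(𝓕 ξ : L2) k‖ ^ 2))) (by fun_prop),
    ← lintegral_const_mul' _ _ ENNReal.ofReal_ne_top,
    ← lintegral_const_mul' _ _ ENNReal.ofReal_ne_top]
  refine lintegral_congr fun k => ?_
  rw [← ENNReal.ofReal_mul (by positivity), ← ENNReal.ofReal_mul (by positivity)]
  congr 1
  field_simp

/-- `[ξ]²_{1/2} = 2π² ∫ ‖p‖ |ξ̂(p)|² dp`. -/
theorem lintegral_gagliardoIntegrand_eq_hat (ξ : L2) :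
    ∫⁻ z : E3 × E3, ENNReal.ofReal (gagliardoIntegrand ξ z) =
      ENNReal.ofReal (2 * Real.pi ^ 2) * ∫⁻ p : E3, ENNReal.ofReal (‖p‖ * ‖hat ξ p‖ ^ 2) := by
  rw [lintegral_gagliardoIntegrand, lintegral_norm_mul_norm_hat_sq, ← mul_assoc,
    ← ENNReal.ofReal_mul (by positivity)]
  ring_nf

theorem integrable_of_lintegral_ofReal_lt_top {α : Type*} [MeasurableSpace α] {μ : Measure α}
    {f : α → ℝ} (hf : Measurable f) (h0 : ∀ x, 0 ≤ f x)
    (h : ∫⁻ x, ENNReal.ofReal (f x) ∂μ < ∞) : Integrable f μ :=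
  ⟨hf.aestronglyMeasurable, (hasFiniteIntegral_iff_ofReal (ae_of_all _ h0)).2 h⟩

theorem gagliardoIntegrand_nonneg (ξ : L2) (z : E3 × E3) : 0 ≤ gagliardoIntegrand ξ z := by
  unfold gagliardoIntegrand
  positivity

theorem gagliardoSq_nonneg (ξ : L2) : 0 ≤ gagliardoSq ξ :=
  integral_nonneg (gagliardoIntegrand_nonneg ξ)

theorem integrable_norm_hat_sq (ξ : L2) : Integrable fun p => ‖hat ξ p‖ ^ 2 := by
  have hm := measurable_hat ξ
  refine integrable_of_lintegral_ofReal_lt_top (by fun_prop) (fun p => by positivity) ?_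
  rw [lintegral_norm_hat_sq]
  exact ENNReal.ofReal_lt_top

/-- Supplies the integrability on balls used by the truncation argument for positivity. -/
theorem locallyIntegrable_hat (ξ : L2) : LocallyIntegrable (hat ξ) :=
  ((memLp_two_iff_integrable_sq_norm (measurable_hat ξ).aestronglyMeasurable).2
    (integrable_norm_hat_sq ξ)).locallyIntegrable (by norm_num)

/-! ### Integrability and size of the individual forms -/

section HHalf

variable {ξ : L2}

theorem MemHHalf.lintegral_norm_mul_norm_hat_sq_lt_top (h : MemHHalf ξ) :
    ∫⁻ p : E3, ENNReal.ofReal (‖p‖ * ‖hat ξ p‖ ^ 2) < ∞ := by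
  rw [lintegral_norm_mul_norm_hat_sq]
  exact ENNReal.mul_lt_top ENNReal.ofReal_lt_top h.lintegral_norm_mul_fourier_lt_top

theorem MemHHalf.integrable_norm_mul_norm_hat_sq (h : MemHHalf ξ) :
    Integrable fun p => ‖p‖ * ‖hat ξ p‖ ^ 2 := by
  have hm := measurable_hat ξ
  exact integrable_of_lintegral_ofReal_lt_top (by fun_prop) (fun p => by positivity)
    h.lintegral_norm_mul_norm_hat_sq_lt_top

theorem MemHHalf.integrable_gagliardoIntegrand (h : MemHHalf ξ) :
    Integrable (gagliardoIntegrand ξ) := by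
  have hu : Measurable ξ := (Lp.stronglyMeasurable ξ).measurable
  refine integrable_of_lintegral_ofReal_lt_top (by unfold gagliardoIntegrand; fun_prop)
    (gagliardoIntegrand_nonneg ξ) ?_
  rw [lintegral_gagliardoIntegrand_eq_hat]
  exact ENNReal.mul_lt_top ENNReal.ofReal_lt_top h.lintegral_norm_mul_norm_hat_sq_lt_top

/-- The constant is the Kato–Herbst π³ divided by the Gagliardo constant 2π². -/
theorem MemHHalf.lintegral_reg_le (h : MemHHalf ξ) :
    ∫⁻ z : E3 × E3, ENNReal.ofReal (‖hat ξ z.1‖ * ‖hat ξ z.2‖ / ‖z.1 - z.2‖ ^ 2) ≤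
      ENNReal.ofReal (Real.pi / 2 * gagliardoSq ξ) := by
  refine (lintegral_mul_div_norm_sub_sq_le (measurable_hat ξ)).trans_eq ?_
  rw [ENNReal.ofReal_mul (by positivity), gagliardoSq,
    ofReal_integral_eq_lintegral_ofReal h.integrable_gagliardoIntegrand
      (ae_of_all _ (gagliardoIntegrand_nonneg ξ)), lintegral_gagliardoIntegrand_eq_hat,
    ← mul_assoc, ← ENNReal.ofReal_mul (by positivity)]
  ring_nf

theorem MemHHalf.integrable_norm_reg (h : MemHHalf ξ) :
    Integrable fun z : E3 × E3 => ‖hat ξ z.1‖ * ‖hat ξ z.2‖ / ‖z.1 - z.2‖ ^ 2 := by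
  have hm := measurable_hat ξ
  exact integrable_of_lintegral_ofReal_lt_top (by fun_prop) (fun p => by positivity)
    (h.lintegral_reg_le.trans_lt ENNReal.ofReal_lt_top)

/-- The Kato–Herbst inequality in terms of the Gagliardo seminorm. -/
theorem MemHHalf.integral_norm_reg_le (h : MemHHalf ξ) :
    ∫ z : E3 × E3, ‖hat ξ z.1‖ * ‖hat ξ z.2‖ / ‖z.1 - z.2‖ ^ 2 ≤
      Real.pi / 2 * gagliardoSq ξ := by
  have h0 := gagliardoSq_nonneg ξ
  rw [← ENNReal.ofReal_le_ofReal_iff (by positivity),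
    ofReal_integral_eq_lintegral_ofReal h.integrable_norm_reg
      (ae_of_all _ fun z => by positivity)]
  exact h.lintegral_reg_le

theorem norm_regIntegrand (ξ : L2) (z : E3 × E3) :
    ‖regIntegrand ξ z‖ = ‖hat ξ z.1‖ * ‖hat ξ z.2‖ / ‖z.1 - z.2‖ ^ 2 := by
  rw [regIntegrand, norm_div, norm_mul, Complex.norm_conj, Complex.norm_real, Real.norm_eq_abs,
    abs_of_nonneg (by positivity)]

theorem norm_offIntegrand {lam : ℝ} (hlam : 0 < lam) (ξ : L2) (z : E3 × E3) :
    ‖offIntegrand lam ξ z‖ =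
      ‖hat ξ z.1‖ * ‖hat ξ z.2‖ / (‖z.1‖ ^ 2 + ‖z.2‖ ^ 2 + inner ℝ z.1 z.2 + lam) := by
  rw [offIntegrand, norm_div, norm_mul, Complex.norm_conj, Complex.norm_real, Real.norm_eq_abs,
    abs_of_pos (off_denom_pos hlam z)]

theorem MemHHalf.integrable_regIntegrand (h : MemHHalf ξ) : Integrable (regIntegrand ξ) := by
  have hm := measurable_hat ξ
  refine h.integrable_norm_reg.mono' ?_ (ae_of_all _ fun z => (norm_regIntegrand ξ z).le)
  unfold regIntegrand
  exact Measurable.aestronglyMeasurable (by fun_prop)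

theorem MemHHalf.integrable_offIntegrand (h : MemHHalf ξ) {lam : ℝ} (hlam : 0 < lam) :
    Integrable (offIntegrand lam ξ) := by
  have hm := measurable_hat ξ
  refine (integrable_div_off_denom hm h.integrable_norm_reg hlam).mono' ?_
    (ae_of_all _ fun z => (norm_offIntegrand hlam ξ z).le)
  unfold offIntegrand
  exact Measurable.aestronglyMeasurable (by fun_prop)

theorem MemHHalf.abs_re_integral_reg_le (h : MemHHalf ξ) :
    |(∫ z : E3 × E3, regIntegrand ξ z).re| ≤ Real.pi / 2 * gagliardoSq ξ := by
  refine (Complex.abs_re_le_norm _).trans ((norm_integral_le_integral_norm _).trans ?_)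
  simp_rw [norm_regIntegrand]
  exact h.integral_norm_reg_le

theorem MemHHalf.abs_re_integral_off_le (h : MemHHalf ξ) {lam : ℝ} (hlam : 0 < lam) :
    |(∫ z : E3 × E3, offIntegrand lam ξ z).re| ≤ 4 * (Real.pi / 2 * gagliardoSq ξ) := by
  refine (Complex.abs_re_le_norm _).trans ((norm_integral_le_integral_norm _).trans ?_)
  refine le_trans ?_ (mul_le_mul_of_nonneg_left h.integral_norm_reg_le zero_le_four)
  rw [← integral_const_mul]
  refine integral_mono_ae (h.integrable_offIntegrand hlam).norm
    (h.integrable_norm_reg.const_mul 4) ?_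
  filter_upwards [ae_fst_ne_snd] with z hz
  rw [norm_offIntegrand hlam]
  exact div_off_denom_le hlam hz (by positivity)

theorem MemHHalf.integrable_diagIntegrand (h : MemHHalf ξ) {lam : ℝ} (hlam : 0 < lam) :
    Integrable (diagIntegrand lam ξ) := by
  have hm := measurable_hat ξ
  refine (h.integrable_norm_mul_norm_hat_sq.add ((integrable_norm_hat_sq ξ).const_mul √lam)).mono'
    (by unfold diagIntegrand; exact Measurable.aestronglyMeasurable (by fun_prop))
    (ae_of_all _ fun p => ?_)
  rw [diagIntegrand, Real.norm_eq_abs, abs_of_nonneg (by positivity), Pi.add_apply, ← add_mul]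
  gcongr
  -- The multiplier is at most |p| + √λ, because ¾|p|² + λ ≤ (|p| + √λ)².
  rw [Real.sqrt_le_left (by positivity)]
  nlinarith [Real.sq_sqrt hlam.le, norm_nonneg p, Real.sqrt_nonneg lam,
    mul_nonneg (norm_nonneg p) (Real.sqrt_nonneg lam), sq_nonneg ‖p‖]

end HHalf

theorem abs_beta_le {a γ b : ℝ} {θ : ℝ → ℝ} (hγ : 0 < γ) (hb : 0 < b)
    (hθ : ∀ s : ℝ, 0 ≤ s → 1 - s / b ≤ θ s ∧ θ s ≤ 1 + s / b) (y : E3) :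
    |beta a γ θ y| ≤ |1 / a| + γ * (1 / b) := by
  have h1 : |(θ ‖y‖ - 1) / ‖y‖| ≤ 1 / b := by
    rw [abs_div, abs_norm]
    -- This form of the division bound allows |y| = 0, where the quotient is 0 by convention.
    refine div_le_of_le_mul₀ (norm_nonneg _) (by positivity) ?_
    obtain ⟨h1, h2⟩ := hθ ‖y‖ (norm_nonneg _)
    rw [one_div_mul_eq_div, abs_le]
    constructor <;> linarith
  calc |beta a γ θ y| ≤ |-(1 / a)| + |γ * ((θ ‖y‖ - 1) / ‖y‖)| := abs_add_le _ _
    _ ≤ _ := by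
      rw [abs_neg, abs_mul, abs_of_pos hγ]
      gcongr

theorem integrable_zeroIntegrand {a γ b : ℝ} {θ : ℝ → ℝ} (hγ : 0 < γ) (hb : 0 < b)
    (hθm : Measurable θ) (hθ : ∀ s : ℝ, 0 ≤ s → 1 - s / b ≤ θ s ∧ θ s ≤ 1 + s / b) (ξ : L2) :
    Integrable (zeroIntegrand a γ θ ξ) := by
  have hu : Measurable ξ := (Lp.stronglyMeasurable ξ).measurable
  have hi : Integrable fun y => ‖ξ y‖ ^ 2 :=
    (memLp_two_iff_integrable_sq_norm hu.aestronglyMeasurable).1 (Lp.memLp ξ)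
  refine (hi.const_mul (|1 / a| + γ * (1 / b))).mono' ?_ (ae_of_all _ fun y => ?_)
  · unfold zeroIntegrand beta
    exact Measurable.aestronglyMeasurable (by fun_prop)
  · rw [zeroIntegrand, norm_mul, norm_pow, norm_norm, Real.norm_eq_abs]
    exact mul_le_mul_of_nonneg_right (abs_beta_le hγ hb hθ y) (by positivity)

end ThreeBosons

/-! ### Assembly of the two bounds -/

theorem proposition3
    (a γ b lam : ℝ) (θ : ℝ → ℝ)
    (ha : a ≠ 0) (hγ : 0 < γ) (hb : 0 < b) (hlam : 0 < lam)
    (hθ_meas : Measurable θ) (hθ_supp : HasCompactSupport θ)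
    (hθ : ∀ s : ℝ, 0 ≤ s → 1 - s / b ≤ θ s ∧ θ s ≤ 1 + s / b)
    (φ : ThreeBosons.L2) (hφ : ThreeBosons.MemHHalf φ) :
    (Integrable (ThreeBosons.diagIntegrand lam φ) ∧
      Integrable (ThreeBosons.offIntegrand lam φ) ∧
      Integrable (ThreeBosons.regIntegrand φ) ∧
      Integrable (ThreeBosons.zeroIntegrand a γ θ φ) ∧
      Integrable (ThreeBosons.gagliardoIntegrand φ)) ∧
    ThreeBosons.phi a γ θ lam φ ≥
      ThreeBosons.phiDiag lam φ + ThreeBosons.phiZero a γ θ φ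
        + 3 * min 0 (γ - 2) * ThreeBosons.gagliardoSq φ ∧
    ThreeBosons.phi a γ θ lam φ ≤
      ThreeBosons.phiDiag lam φ + ThreeBosons.phiZero a γ θ φ
        + (3 * γ + 96 * √3 / Real.pi) * ThreeBosons.gagliardoSq φ := by
  refine ⟨⟨hφ.integrable_diagIntegrand hlam, hφ.integrable_offIntegrand hlam,
    hφ.integrable_regIntegrand, ThreeBosons.integrable_zeroIntegrand hγ hb hθ_meas hθ φ,
    hφ.integrable_gagliardoIntegrand⟩, ?_⟩
  have hr := abs_le.1 hφ.abs_re_integral_reg_le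
  have ho := abs_le.1 (hφ.abs_re_integral_off_le hlam)
  have hpos : ∀ {ε : ℝ}, 0 ≤ ε → ε ≤ 1 → 0 ≤ (∫ z, ThreeBosons.regIntegrand φ z).re -
      ε * (∫ z, ThreeBosons.offIntegrand lam φ z).re := fun h0 h1 =>
    ThreeBosons.integral_kernel_diff_re_nonneg (ThreeBosons.measurable_hat φ)
      (ThreeBosons.locallyIntegrable_hat φ) hφ.integrable_norm_reg hlam h0 h1
  have hreg := hpos le_rfl zero_le_one
  have hdiff := hpos zero_le_one le_rfl
  rw [zero_mul, sub_zero] at hreg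
  rw [one_mul] at hdiff
  have hQ := ThreeBosons.gagliardoSq_nonneg φ
  rw [ThreeBosons.phi, ThreeBosons.phiOff, ThreeBosons.phiReg]
  generalize (∫ z, ThreeBosons.regIntegrand φ z).re = r at *
  generalize (∫ z, ThreeBosons.offIntegrand lam φ z).re = o at *
  generalize ThreeBosons.gagliardoSq φ = Q at *
  have hπ := Real.pi_pos
  constructor
  · suffices h : 3 * min 0 (γ - 2) * Q ≤ -(12 / Real.pi) * o + 6 * γ / Real.pi * r by linarith
    -- Two units of γ are spent on making r - o appear; the sign of γ - 2 decides which side of 0 ≤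
    -- r ≤ (π/2) Q is used for the rest.
    have e : -(12 / Real.pi) * o + 6 * γ / Real.pi * r =
        12 / Real.pi * (r - o) + 6 / Real.pi * ((γ - 2) * r) := by ring
    have h1 : 0 ≤ 12 / Real.pi * (r - o) := by positivity
    rw [e]
    rcases le_total 2 γ with h2 | h2
    · rw [min_eq_left (by linarith)]
      have : 0 ≤ 6 / Real.pi * ((γ - 2) * r) :=
        mul_nonneg (by positivity) (mul_nonneg (by linarith) hreg)
      linarith
    · rw [min_eq_right (by linarith)]
      have : 6 / Real.pi * ((γ - 2) * (Real.pi / 2 * Q)) ≤ 6 / Real.pi * ((γ - 2) * r) :=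
        mul_le_mul_of_nonneg_left (mul_le_mul_of_nonpos_left hr.2 (by linarith)) (by positivity)
      have e2 : 6 / Real.pi * ((γ - 2) * (Real.pi / 2 * Q)) = 3 * (γ - 2) * Q := by
        field_simp
        ring
      linarith
  · suffices h : -(12 / Real.pi) * o + 6 * γ / Real.pi * r ≤ (3 * γ + 96 * √3 / Real.pi) * Q by
      linarith
    have h1 : 6 * γ / Real.pi * r ≤ 6 * γ / Real.pi * (Real.pi / 2 * Q) :=
      mul_le_mul_of_nonneg_left hr.2 (by positivity)
    have h2 : 12 / Real.pi * -o ≤ 12 / Real.pi * (4 * (Real.pi / 2 * Q)) :=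
      mul_le_mul_of_nonneg_left (by linarith [ho.1]) (by positivity)
    have e1 : 6 * γ / Real.pi * (Real.pi / 2 * Q) = 3 * γ * Q := by
      field_simp
      ring
    have e2 : 12 / Real.pi * (4 * (Real.pi / 2 * Q)) = 24 * Q := by
      field_simp
      ring
    -- The comparison of kernels yields the smaller constant 24; π ≤ 4 and √3 ≥ 1 already place it
    -- below the stated one.
    have h3 : 24 ≤ 96 * √3 / Real.pi := by
      rw [le_div_iff₀ hπ]
      have : (1 : ℝ) ≤ √3 := Real.one_le_sqrt.2 (by norm_num)
      nlinarith [Real.pi_le_four]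
    have h4 := mul_le_mul_of_nonneg_right h3 hQ
    linarith
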